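/- **Language.** Fix countable sets of individual constants $k$, of $n$-ary predicate symbols $P$, and, for each $n\ge 1$, of $n$-ary relational constants $K$. There are countably infinitely many individual variables $x,y,\dots$ and individual parameters $a,\dots$, and for each $n\ge 1$ countably infinitely many $n$-ary relational variables $X,Y,\dots$ and parameters $A,\dots$. Terms are individual variables, parameters and constants. Formulas are built from $t_1=t_2$, $P(t_1,\dots,t_n)$, $U=V$, $U(t_1,\dots,t_n)$ (the atomic formulas; $U,V$ being $n$-ary relational variables, parameters or constants) by $\neg,\wedge,\vee,\to,\leftrightarrow$, $\forall x,\exists x,\forall X,\exists X$, and the formulas $(\lambda x\,\psi)t$, $(\lambda x\,\psi)\iota y\,\varphi$ and $(\lambda X\psi)\iota Y\varphi$ ($X,Y$ of the same arity), where $\lambda$ binds in $\psi$ only and $\iota$ in $\varphi$ only. A sequent $\Gamma\Rightarrow\Delta$ is a pair of finite multisets of formulas in which no variable occurs free (parameters play the role of free variables). A *name* is a parameter or a constant, individual or relational; $\varphi^x_b$, $\varphi^X_B$ denote substitution of a name for the free occurrences of a variable. **Semantics.** A general model $\mathfrak M$ consists of a set $D$, elements $I(k)\in D$, relations $I(P)\subseteq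 D^n$, and for each $n\ge1$ a set $G_n\subseteq\mathcal P(D^n)$ with $I(K)\in G_n$ for every $n$-ary $K$. An assignment $v$ maps individual variables and parameters into $D$ and $n$-ary relational variables and parameters into $G_n$. Satisfaction is as usual, with $\forall X,\exists X$ ranging over $G_n$, $U=V$ meaning equality of the values, $\mathfrak M,v\models(\lambda x\,\psi)t$ iff $\mathfrak M,v^x_{v(t)}\models\psi$, and $\mathfrak M,v\models(\lambda x\,\psi)\iota y\,\varphi$ iff there is $o\in D$ with $\mathfrak M,v^x_o\models\psi$, $\mathfrak M,v^y_o\models\varphi$, and $o'=o$ whenever $\mathfrak M,v^y_{o'}\models\varphi$; likewise for $(\lambda X\psi)\iota Y\varphi$ with $O\in G_n$. A sequent $\Gamma\Rightarrow\Delta$ holds in $\mathfrak M$ under $v$ if, whenever all formulas of $\Gamma$ are satisfied, some formula of $\Delta$ is. Write $\mathcal S\models H$ if for all $\mathfrak M$ and $v$: if every sequent of $\mathcal S$ holds in $\mathfrak M$ under $v$, so does $H$. Write $\mathcal S\models^{g}H$ if every $\mathfrak M$ in which all sequents of $\mathcal S$ hold under all assignments is one in which $H$ holds under all assignments. **Calculus.**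 The axioms are $\varphi\Rightarrow\varphi$. The rules are cut (from $\Gamma\Rightarrow\Delta,\varphi$ and $\varphi,\Pi\Rightarrow\Sigma$ infer $\Gamma,\Pi\Rightarrow\Delta,\Sigma$), weakening and contraction on both sides; the usual two-sided context-sharing rules for $\neg,\wedge,\vee,\to,\leftrightarrow$ (with $\wedge\Rightarrow$ and $\Rightarrow\vee$ in the form with both components in the premise); and the following, where $b,b_i,c$ and $B,C$ are arbitrary names and $a$, $A$ are parameters not occurring in the conclusion and different from $b$, $B$: * $\forall x\varphi,\Gamma\Rightarrow\Delta$ from $\varphi^x_b,\Gamma\Rightarrow\Delta$; $\Gamma\Rightarrow\Delta,\forall x\varphi$ from $\Gamma\Rightarrow\Delta,\varphi^x_a$; dually for $\exists x$; and the same rules for $\forall X,\exists X$ with $B$, $A$; * $\Gamma\Rightarrow\Delta$ from $b=b,\Gamma\Rightarrow\Delta$; and $b=c,\mathscr A^x_b,\Gamma\Rightarrow\Delta$ from $\mathscr A^x_c,\Gamma\Rightarrow\Delta$ with $\mathscr A$ atomic; * $(\lambda x\psi)b,\Gamma\Rightarrow\Delta$ from $\psi^x_b,\Gamma\Rightarrow\Delta$;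 $\Gamma\Rightarrow\Delta,(\lambda x\psi)b$ from $\Gamma\Rightarrow\Delta,\psi^x_b$; * $(\lambda x\psi)\iota y\varphi,\Gamma\Rightarrow\Delta$ from $\varphi^y_a,\psi^x_a,\Gamma\Rightarrow\Delta$; the same conclusion from $\Gamma\Rightarrow\Delta,\varphi^y_b$ and $\Gamma\Rightarrow\Delta,\varphi^y_c$ and $b=c,\Gamma\Rightarrow\Delta$; $\Gamma\Rightarrow\Delta,(\lambda x\psi)\iota y\varphi$ from $\Gamma\Rightarrow\Delta,\varphi^y_b$ and $\Gamma\Rightarrow\Delta,\psi^x_b$ and $\varphi^y_a,\Gamma\Rightarrow\Delta,a=b$; and the same three rules for $(\lambda X\psi)\iota Y\varphi$ with $A,B,C$; * $B=C,\Gamma\Rightarrow\Delta$ from $\Gamma\Rightarrow\Delta,B(\vec b),C(\vec b)$ and $B(\vec b),C(\vec b),\Gamma\Rightarrow\Delta$; $\Gamma\Rightarrow\Delta,B=C$ from $B(\vec a),\Gamma\Rightarrow\Delta,C(\vec a)$ and $C(\vec a),\Gamma\Rightarrow\Delta,B(\vec a)$, where $\vec a$ are distinct individual parameters not occurring in $\Gamma,\Delta$.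 Write $\mathcal S\vdash^{cf}H$ if there is a proof tree with root $H$ whose leaves are axioms or members of $\mathcal S$ and in which every cut formula is a formula of some sequent of $\mathcal S$. **Theorem (strong completeness).** Let $\mathcal S$ be a set of sequents and $H$ a sequent. If $\mathcal S\models H$, then $\mathcal S\vdash^{cf}H$. Moreover, if $\mathcal S$ is closed under simultaneous substitution of names for parameters (individual names for individual parameters, $n$-ary relational names for $n$-ary relational parameters), then already $\mathcal S\models^{g}H$ implies $\mathcal S\vdash^{cf}H$. -/

import Mathlib

namespace RLL

/-- The non-logical symbols: individual constants, `n`-ary predicate symbols, and, for each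
`n ≥ 1`, the `n`-ary relational constants. -/
structure Signature where
  Con : Type
  Pred : ℕ → Type
  RelCon : ℕ+ → Type

/-- Individual names: parameters (the free variables of the proof theory) and constants. -/
inductive Name (L : Signature) : Type
  | par (a : ℕ) : Name L
  | con (k : L.Con) : Name L

/-- Terms: individual variables, parameters and constants. -/
inductive Term (L : Signature) : Type
  | var (x : ℕ) : Term L
  | name (b : Name L) : Term L

/-- `n`-ary relational names: relational parameters and relational constants. -/
inductive RelName (L : Signature) (n : ℕ+) : Type
  | par (A : ℕ) : RelName L n
  | con (K : L.RelCon n) : RelName L n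

/-- `n`-ary relational variables, parameters and constants. -/
inductive RelTerm (L : Signature) (n : ℕ+) : Type
  | var (X : ℕ) : RelTerm L n
  | name (B : RelName L n) : RelTerm L n

/-- Formulas of the second-order language with `λ` and `ι`. -/
inductive Formula (L : Signature) : Type
  /-- `t = s` -/
  | eq (t s : Term L) : Formula L
  /-- `P(t₁, …, tₙ)` -/
  | pred {n : ℕ} (P : L.Pred n) (ts : Fin n → Term L) : Formula L
  /-- `X = Y` for relational `X`, `Y` of the same arity -/
  | relEq {n : ℕ+} (X Y : RelTerm L n) : Formula L
  /-- `X(t₁, …, tₙ)` -/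
  | rel {n : ℕ+} (X : RelTerm L n) (ts : Fin n → Term L) : Formula L
  | neg (φ : Formula L) : Formula L
  | and (φ ψ : Formula L) : Formula L
  | or (φ ψ : Formula L) : Formula L
  | imp (φ ψ : Formula L) : Formula L
  | iff (φ ψ : Formula L) : Formula L
  | all (x : ℕ) (φ : Formula L) : Formula L
  | ex (x : ℕ) (φ : Formula L) : Formula L
  /-- `(λx ψ) t` -/
  | lam (x : ℕ) (ψ : Formula L) (t : Term L) : Formula L
  /-- `(λx ψ) ιy φ`; here `λx` binds in `ψ` only and `ιy` binds in `φ` only -/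
  | lamIota (x : ℕ) (ψ : Formula L) (y : ℕ) (φ : Formula L) : Formula L
  /-- `∀X φ`, with `X` of arity `n` -/
  | all2 (n : ℕ+) (X : ℕ) (φ : Formula L) : Formula L
  /-- `∃X φ`, with `X` of arity `n` -/
  | ex2 (n : ℕ+) (X : ℕ) (φ : Formula L) : Formula L
  /-- `(λX ψ) ιY φ`, with `X` and `Y` of arity `n`; `λX` binds in `ψ` only, `ιY` in `φ` only -/
  | lamIota2 (n : ℕ+) (X : ℕ) (ψ : Formula L) (Y : ℕ) (φ : Formula L) : Formula L

variable {L : Signature}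

/-! ### Syntax: occurrences and substitution -/

/-- The individual variable `z` is the term `t`. -/
def Term.HasVar (z : ℕ) : Term L → Prop
  | .var x => x = z
  | .name _ => False

/-- The individual parameter `a` is the term `t`. -/
def Term.HasPar (a : ℕ) : Term L → Prop
  | .name (.par a') => a' = a
  | _ => False

/-- The `m`-ary relational variable `Z` is the given relational term. -/
def RelTerm.HasVar (m : ℕ+) (Z : ℕ) {n : ℕ+} : RelTerm L n → Prop
  | .var X => n = m ∧ X = Z
  | .name _ => False

/-- The `m`-ary relational parameter `A` is the given relational term. -/
def RelTerm.HasPar (m : ℕ+) (A : ℕ) {n : ℕ+} : RelTerm L n → Prop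
  | .name (.par A') => n = m ∧ A' = A
  | _ => False

/-- The term `t` with the variable `x` replaced by the name `b`. -/
def Term.subst (x : ℕ) (b : Name L) : Term L → Term L
  | .var y => if y = x then .name b else .var y
  | .name c => .name c

/-- A relational term with the `n`-ary relational variable `X` replaced by the name `B`. -/
def RelTerm.subst (n : ℕ+) (X : ℕ) (B : RelName L n) {m : ℕ+} : RelTerm L m → RelTerm L m
  | .var Y => if h : n = m then (if Y = X then .name (h ▸ B) else .var Y) else .var Y
  | .name C => .name C

namespace Formula

/-- The individual variable `z` occurs free in the formula. -/
def HasFree (z : ℕ) : Formula L → Prop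
  | eq t s => t.HasVar z ∨ s.HasVar z
  | pred _ ts => ∃ i, (ts i).HasVar z
  | relEq _ _ => False
  | rel _ ts => ∃ i, (ts i).HasVar z
  | neg φ => φ.HasFree z
  | and φ ψ => φ.HasFree z ∨ ψ.HasFree z
  | or φ ψ => φ.HasFree z ∨ ψ.HasFree z
  | imp φ ψ => φ.HasFree z ∨ ψ.HasFree z
  | iff φ ψ => φ.HasFree z ∨ ψ.HasFree z
  | all x φ => x ≠ z ∧ φ.HasFree z
  | ex x φ => x ≠ z ∧ φ.HasFree z
  | lam x ψ t => (x ≠ z ∧ ψ.HasFree z) ∨ t.HasVar z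
  | lamIota x ψ y φ => (x ≠ z ∧ ψ.HasFree z) ∨ (y ≠ z ∧ φ.HasFree z)
  | all2 _ _ φ => φ.HasFree z
  | ex2 _ _ φ => φ.HasFree z
  | lamIota2 _ _ ψ _ φ => ψ.HasFree z ∨ φ.HasFree z

/-- The `m`-ary relational variable `Z` occurs free in the formula. -/
def HasFreeRel (m : ℕ+) (Z : ℕ) : Formula L → Prop
  | eq _ _ => False
  | pred _ _ => False
  | relEq X Y => X.HasVar m Z ∨ Y.HasVar m Z
  | rel X _ => X.HasVar m Z
  | neg φ => φ.HasFreeRel m Z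
  | and φ ψ => φ.HasFreeRel m Z ∨ ψ.HasFreeRel m Z
  | or φ ψ => φ.HasFreeRel m Z ∨ ψ.HasFreeRel m Z
  | imp φ ψ => φ.HasFreeRel m Z ∨ ψ.HasFreeRel m Z
  | iff φ ψ => φ.HasFreeRel m Z ∨ ψ.HasFreeRel m Z
  | all _ φ => φ.HasFreeRel m Z
  | ex _ φ => φ.HasFreeRel m Z
  | lam _ ψ _ => ψ.HasFreeRel m Z
  | lamIota _ ψ _ φ => ψ.HasFreeRel m Z ∨ φ.HasFreeRel m Z
  | all2 n X φ => ¬ (n = m ∧ X = Z) ∧ φ.HasFreeRel m Z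
  | ex2 n X φ => ¬ (n = m ∧ X = Z) ∧ φ.HasFreeRel m Z
  | lamIota2 n X ψ Y φ =>
      (¬ (n = m ∧ X = Z) ∧ ψ.HasFreeRel m Z) ∨ (¬ (n = m ∧ Y = Z) ∧ φ.HasFreeRel m Z)

/-- No variable, individual or relational, occurs free: parameters are the only free symbols.
These are the formulas of the sequent calculus. -/
def Closed (φ : Formula L) : Prop :=
  (∀ z, ¬ φ.HasFree z) ∧ ∀ m Z, ¬ φ.HasFreeRel m Z

/-- The individual parameter `a` occurs in the formula. -/
def HasPar (a : ℕ) : Formula L → Prop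
  | eq t s => t.HasPar a ∨ s.HasPar a
  | pred _ ts => ∃ i, (ts i).HasPar a
  | relEq _ _ => False
  | rel _ ts => ∃ i, (ts i).HasPar a
  | neg φ => φ.HasPar a
  | and φ ψ => φ.HasPar a ∨ ψ.HasPar a
  | or φ ψ => φ.HasPar a ∨ ψ.HasPar a
  | imp φ ψ => φ.HasPar a ∨ ψ.HasPar a
  | iff φ ψ => φ.HasPar a ∨ ψ.HasPar a
  | all _ φ => φ.HasPar a
  | ex _ φ => φ.HasPar a
  | lam _ ψ t => ψ.HasPar a ∨ t.HasPar a
  | lamIota _ ψ _ φ => ψ.HasPar a ∨ φ.HasPar a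
  | all2 _ _ φ => φ.HasPar a
  | ex2 _ _ φ => φ.HasPar a
  | lamIota2 _ _ ψ _ φ => ψ.HasPar a ∨ φ.HasPar a

/-- The `m`-ary relational parameter `A` occurs in the formula. -/
def HasRelPar (m : ℕ+) (A : ℕ) : Formula L → Prop
  | eq _ _ => False
  | pred _ _ => False
  | relEq X Y => X.HasPar m A ∨ Y.HasPar m A
  | rel X _ => X.HasPar m A
  | neg φ => φ.HasRelPar m A
  | and φ ψ => φ.HasRelPar m A ∨ ψ.HasRelPar m A
  | or φ ψ => φ.HasRelPar m A ∨ ψ.HasRelPar m A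
  | imp φ ψ => φ.HasRelPar m A ∨ ψ.HasRelPar m A
  | iff φ ψ => φ.HasRelPar m A ∨ ψ.HasRelPar m A
  | all _ φ => φ.HasRelPar m A
  | ex _ φ => φ.HasRelPar m A
  | lam _ ψ _ => ψ.HasRelPar m A
  | lamIota _ ψ _ φ => ψ.HasRelPar m A ∨ φ.HasRelPar m A
  | all2 _ _ φ => φ.HasRelPar m A
  | ex2 _ _ φ => φ.HasRelPar m A
  | lamIota2 _ _ ψ _ φ => ψ.HasRelPar m A ∨ φ.HasRelPar m A

/-- Substitution of the name `b` for the free occurrences of the variable `x`. Names are never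
captured, so bound variables need no renaming. -/
def subst (x : ℕ) (b : Name L) : Formula L → Formula L
  | eq t s => eq (t.subst x b) (s.subst x b)
  | pred P ts => pred P fun i => (ts i).subst x b
  | relEq X Y => relEq X Y
  | rel X ts => rel X fun i => (ts i).subst x b
  | neg φ => neg (φ.subst x b)
  | and φ ψ => and (φ.subst x b) (ψ.subst x b)
  | or φ ψ => or (φ.subst x b) (ψ.subst x b)
  | imp φ ψ => imp (φ.subst x b) (ψ.subst x b)
  | iff φ ψ => iff (φ.subst x b) (ψ.subst x b)
  | all z φ => all z (if z = x then φ else φ.subst x b)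
  | ex z φ => ex z (if z = x then φ else φ.subst x b)
  | lam z ψ t => lam z (if z = x then ψ else ψ.subst x b) (t.subst x b)
  | lamIota z ψ y φ =>
      lamIota z (if z = x then ψ else ψ.subst x b) y (if y = x then φ else φ.subst x b)
  | all2 n X φ => all2 n X (φ.subst x b)
  | ex2 n X φ => ex2 n X (φ.subst x b)
  | lamIota2 n X ψ Y φ => lamIota2 n X (ψ.subst x b) Y (φ.subst x b)

/-- Substitution of the relational name `B` for the free occurrences of the `n`-ary relational
variable `X`. -/
def substRel (n : ℕ+) (X : ℕ) (B : RelName L n) : Formula L → Formula L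
  | eq t s => eq t s
  | pred P ts => pred P ts
  | relEq Y Z => relEq (Y.subst n X B) (Z.subst n X B)
  | rel Y ts => rel (Y.subst n X B) ts
  | neg φ => neg (φ.substRel n X B)
  | and φ ψ => and (φ.substRel n X B) (ψ.substRel n X B)
  | or φ ψ => or (φ.substRel n X B) (ψ.substRel n X B)
  | imp φ ψ => imp (φ.substRel n X B) (ψ.substRel n X B)
  | iff φ ψ => iff (φ.substRel n X B) (ψ.substRel n X B)
  | all z φ => all z (φ.substRel n X B)
  | ex z φ => ex z (φ.substRel n X B)
  | lam z ψ t => lam z (ψ.substRel n X B) t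
  | lamIota z ψ y φ => lamIota z (ψ.substRel n X B) y (φ.substRel n X B)
  | all2 m Z φ => all2 m Z (if m = n ∧ Z = X then φ else φ.substRel n X B)
  | ex2 m Z φ => ex2 m Z (if m = n ∧ Z = X then φ else φ.substRel n X B)
  | lamIota2 m Z ψ Y φ =>
      lamIota2 m Z (if m = n ∧ Z = X then ψ else ψ.substRel n X B)
        Y (if m = n ∧ Y = X then φ else φ.substRel n X B)

/-- Atomic formulas (lambda atoms are not among them). -/
def IsAtomic : Formula L → Prop
  | eq _ _ => True
  | pred _ _ => True
  | relEq _ _ => True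
  | rel _ _ => True
  | _ => False

end Formula

/-- A simultaneous substitution of names for the individual and relational parameters. -/
structure ParSubst (L : Signature) where
  ind : ℕ → Name L
  rel : (n : ℕ+) → ℕ → RelName L n

def Term.parSubst (σ : ParSubst L) : Term L → Term L
  | .name (.par a) => .name (σ.ind a)
  | t => t

def RelTerm.parSubst (σ : ParSubst L) {n : ℕ+} : RelTerm L n → RelTerm L n
  | .name (.par A) => .name (σ.rel n A)
  | X => X

def Formula.parSubst (σ : ParSubst L) : Formula L → Formula L
  | eq t s => eq (t.parSubst σ) (s.parSubst σ)
  | pred P ts => pred P fun i => (ts i).parSubst σ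
  | relEq X Y => relEq (X.parSubst σ) (Y.parSubst σ)
  | rel X ts => rel (X.parSubst σ) fun i => (ts i).parSubst σ
  | neg φ => neg (φ.parSubst σ)
  | and φ ψ => and (φ.parSubst σ) (ψ.parSubst σ)
  | or φ ψ => or (φ.parSubst σ) (ψ.parSubst σ)
  | imp φ ψ => imp (φ.parSubst σ) (ψ.parSubst σ)
  | iff φ ψ => iff (φ.parSubst σ) (ψ.parSubst σ)
  | all x φ => all x (φ.parSubst σ)
  | ex x φ => ex x (φ.parSubst σ)
  | lam x ψ t => lam x (ψ.parSubst σ) (t.parSubst σ)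
  | lamIota x ψ y φ => lamIota x (ψ.parSubst σ) y (φ.parSubst σ)
  | all2 n X φ => all2 n X (φ.parSubst σ)
  | ex2 n X φ => ex2 n X (φ.parSubst σ)
  | lamIota2 n X ψ Y φ => lamIota2 n X (ψ.parSubst σ) Y (φ.parSubst σ)

/-! ### Semantics: general models -/

/-- A general model: a domain `D` with an interpretation of the symbols, and for each arity
`n ≥ 1` a set `G n` of `n`-ary relations on `D`. Nothing is required of `G n` except that it
contains the interpretations of the `n`-ary relational constants. -/
structure GeneralModel (L : Signature) where
  D : Type
  con : L.Con → D
  pred : {n : ℕ} → L.Pred n → Set (Fin n → D)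
  G : (n : ℕ+) → Set (Set (Fin n → D))
  relCon : {n : ℕ+} → L.RelCon n → G n

/-- An assignment: variables and parameters take values in `D`, respectively in `G n`. -/
structure Assignment (M : GeneralModel L) where
  var : ℕ → M.D
  par : ℕ → M.D
  relVar : (n : ℕ+) → ℕ → M.G n
  relPar : (n : ℕ+) → ℕ → M.G n

namespace Assignment

variable {M : GeneralModel L}

/-- The `x`-variant of `v` with value `o` at `x`. -/
def update (v : Assignment M) (x : ℕ) (o : M.D) : Assignment M :=
  { v with var := Function.update v.var x o }

/-- The `X`-variant of `v` with value `O` at the `n`-ary relational variable `X`. -/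
def updateRel (v : Assignment M) (n : ℕ+) (X : ℕ) (O : M.G n) : Assignment M :=
  { v with relVar := Function.update v.relVar n (Function.update (v.relVar n) X O) }

/-- The value of a term. -/
def term (v : Assignment M) : Term L → M.D
  | .var x => v.var x
  | .name (.par a) => v.par a
  | .name (.con k) => M.con k

/-- The value of a relational term. -/
def relTerm (v : Assignment M) {n : ℕ+} : RelTerm L n → M.G n
  | .var X => v.relVar n X
  | .name (.par A) => v.relPar n A
  | .name (.con K) => M.relCon K

end Assignment

/-- Satisfaction of a formula in a general model under an assignment. -/
def Sat (M : GeneralModel L) : Assignment M → Formula L → Prop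
  | v, .eq t s => v.term t = v.term s
  | v, .pred P ts => (fun i => v.term (ts i)) ∈ M.pred P
  | v, .relEq X Y => v.relTerm X = v.relTerm Y
  | v, .rel X ts => (fun i => v.term (ts i)) ∈ (v.relTerm X).1
  | v, .neg φ => ¬ Sat M v φ
  | v, .and φ ψ => Sat M v φ ∧ Sat M v ψ
  | v, .or φ ψ => Sat M v φ ∨ Sat M v ψ
  | v, .imp φ ψ => Sat M v φ → Sat M v ψ
  | v, .iff φ ψ => (Sat M v φ ↔ Sat M v ψ)
  | v, .all x φ => ∀ o : M.D, Sat M (v.update x o) φ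
  | v, .ex x φ => ∃ o : M.D, Sat M (v.update x o) φ
  | v, .lam x ψ t => Sat M (v.update x (v.term t)) ψ
  | v, .lamIota x ψ y φ => ∃ o : M.D, Sat M (v.update x o) ψ ∧ Sat M (v.update y o) φ ∧
      ∀ o' : M.D, Sat M (v.update y o') φ → o' = o
  | v, .all2 n X φ => ∀ O : M.G n, Sat M (v.updateRel n X O) φ
  | v, .ex2 n X φ => ∃ O : M.G n, Sat M (v.updateRel n X O) φ
  | v, .lamIota2 n X ψ Y φ => ∃ O : M.G n, Sat M (v.updateRel n X O) ψ ∧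
      Sat M (v.updateRel n Y O) φ ∧ ∀ O' : M.G n, Sat M (v.updateRel n Y O') φ → O' = O

/-- A sequent `Γ ⇒ Δ`, with `Γ` and `Δ` finite multisets of formulas. -/
structure Sequent (L : Signature) where
  ant : Multiset (Formula L)
  suc : Multiset (Formula L)

namespace Sequent

/-- The formula `φ` belongs to the sequent. -/
def Has (H : Sequent L) (φ : Formula L) : Prop := φ ∈ H.ant ∨ φ ∈ H.suc

/-- All formulas of the sequent are closed, so that it is a sequent of the calculus. -/
def Closed (H : Sequent L) : Prop := ∀ φ, H.Has φ → φ.Closed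

/-- Substitution of names for parameters throughout a sequent. -/
def parSubst (σ : ParSubst L) (H : Sequent L) : Sequent L :=
  ⟨H.ant.map (Formula.parSubst σ), H.suc.map (Formula.parSubst σ)⟩

/-- The sequent holds in `M` under `v`: if `v` satisfies all formulas on the left, it satisfies
one on the right. -/
def Holds (M : GeneralModel L) (v : Assignment M) (H : Sequent L) : Prop :=
  (∀ φ ∈ H.ant, Sat M v φ) → ∃ ψ ∈ H.suc, Sat M v ψ

end Sequent

/-- `H` follows from `S`: for every general model `M` and every assignment `v`, if all sequents
of `S` hold in `M` under `v`, so does `H`. -/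
def Entails (S : Set (Sequent L)) (H : Sequent L) : Prop :=
  ∀ (M : GeneralModel L) (v : Assignment M), (∀ s ∈ S, s.Holds M v) → H.Holds M v

/-- Every general model of `S` is a model of `H`, where being a model of a sequent means that
the sequent holds under all assignments. -/
def EntailsGlobally (S : Set (Sequent L)) (H : Sequent L) : Prop :=
  ∀ M : GeneralModel L, (∀ s ∈ S, ∀ v : Assignment M, s.Holds M v) →
    ∀ v : Assignment M, H.Holds M v

/-- `S` contains, with each sequent, all its substitution instances. -/
def SubstClosed (S : Set (Sequent L)) : Prop :=
  ∀ s ∈ S, ∀ σ : ParSubst L, s.parSubst σ ∈ S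

/-! ### The sequent calculus -/

/-- The individual parameter `a` does not occur in `Γ`. -/
def Fresh (a : ℕ) (Γ : Multiset (Formula L)) : Prop := ∀ χ ∈ Γ, ¬ χ.HasPar a

/-- The `n`-ary relational parameter `A` does not occur in `Γ`. -/
def FreshRel (n : ℕ+) (A : ℕ) (Γ : Multiset (Formula L)) : Prop := ∀ χ ∈ Γ, ¬ χ.HasRelPar n A

/-- `Deriv S C Γ Δ`: there is a proof tree with root `Γ ⇒ Δ`, whose leaves are axioms or members
of `S`, and in which every cut is on a formula of `C`. The proof is built from formulas without
free variables; the side conditions `Closed` ensure this where the premises do not.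
Eigenvariables are parameters, `b`, `c`, `B`, `C` stand for arbitrary parameters or constants. -/
inductive Deriv (S : Set (Sequent L)) (C : Set (Formula L)) :
    Multiset (Formula L) → Multiset (Formula L) → Prop
  | hyp {H : Sequent L} (h : H ∈ S) : Deriv S C H.ant H.suc
  | ax {φ : Formula L} (h : φ.Closed) : Deriv S C {φ} {φ}
  | cut {Γ Δ Θ Λ : Multiset (Formula L)} {φ : Formula L} (hφ : φ ∈ C) :
      Deriv S C Γ (φ ::ₘ Δ) → Deriv S C (φ ::ₘ Θ) Λ → Deriv S C (Γ + Θ) (Δ + Λ)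
  | weakL {Γ Δ : Multiset (Formula L)} {φ : Formula L} (h : φ.Closed) :
      Deriv S C Γ Δ → Deriv S C (φ ::ₘ Γ) Δ
  | weakR {Γ Δ : Multiset (Formula L)} {φ : Formula L} (h : φ.Closed) :
      Deriv S C Γ Δ → Deriv S C Γ (φ ::ₘ Δ)
  | contrL {Γ Δ : Multiset (Formula L)} {φ : Formula L} :
      Deriv S C (φ ::ₘ φ ::ₘ Γ) Δ → Deriv S C (φ ::ₘ Γ) Δ
  | contrR {Γ Δ : Multiset (Formula L)} {φ : Formula L} :
      Deriv S C Γ (φ ::ₘ φ ::ₘ Δ) → Deriv S C Γ (φ ::ₘ Δ)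
  | andL {Γ Δ : Multiset (Formula L)} {φ ψ : Formula L} :
      Deriv S C (φ ::ₘ ψ ::ₘ Γ) Δ → Deriv S C (.and φ ψ ::ₘ Γ) Δ
  | andR {Γ Δ : Multiset (Formula L)} {φ ψ : Formula L} :
      Deriv S C Γ (φ ::ₘ Δ) → Deriv S C Γ (ψ ::ₘ Δ) → Deriv S C Γ (.and φ ψ ::ₘ Δ)
  | negL {Γ Δ : Multiset (Formula L)} {φ : Formula L} :
      Deriv S C Γ (φ ::ₘ Δ) → Deriv S C (.neg φ ::ₘ Γ) Δ
  | negR {Γ Δ : Multiset (Formula L)} {φ : Formula L} :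
      Deriv S C (φ ::ₘ Γ) Δ → Deriv S C Γ (.neg φ ::ₘ Δ)
  | orL {Γ Δ : Multiset (Formula L)} {φ ψ : Formula L} :
      Deriv S C (φ ::ₘ Γ) Δ → Deriv S C (ψ ::ₘ Γ) Δ → Deriv S C (.or φ ψ ::ₘ Γ) Δ
  | orR {Γ Δ : Multiset (Formula L)} {φ ψ : Formula L} :
      Deriv S C Γ (φ ::ₘ ψ ::ₘ Δ) → Deriv S C Γ (.or φ ψ ::ₘ Δ)
  | impL {Γ Δ : Multiset (Formula L)} {φ ψ : Formula L} :
      Deriv S C Γ (φ ::ₘ Δ) → Deriv S C (ψ ::ₘ Γ) Δ → Deriv S C (.imp φ ψ ::ₘ Γ) Δ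
  | impR {Γ Δ : Multiset (Formula L)} {φ ψ : Formula L} :
      Deriv S C (φ ::ₘ Γ) (ψ ::ₘ Δ) → Deriv S C Γ (.imp φ ψ ::ₘ Δ)
  | iffL {Γ Δ : Multiset (Formula L)} {φ ψ : Formula L} :
      Deriv S C Γ (φ ::ₘ ψ ::ₘ Δ) → Deriv S C (φ ::ₘ ψ ::ₘ Γ) Δ →
      Deriv S C (.iff φ ψ ::ₘ Γ) Δ
  | iffR {Γ Δ : Multiset (Formula L)} {φ ψ : Formula L} :
      Deriv S C (φ ::ₘ Γ) (ψ ::ₘ Δ) → Deriv S C (ψ ::ₘ Γ) (φ ::ₘ Δ) →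
      Deriv S C Γ (.iff φ ψ ::ₘ Δ)
  | allL {Γ Δ : Multiset (Formula L)} {x : ℕ} {φ : Formula L} (b : Name L) :
      Deriv S C (φ.subst x b ::ₘ Γ) Δ → Deriv S C (.all x φ ::ₘ Γ) Δ
  | allR {Γ Δ : Multiset (Formula L)} {x : ℕ} {φ : Formula L} (a : ℕ)
      (hΓ : Fresh a Γ) (hΔ : Fresh a Δ) (hφ : ¬ φ.HasPar a) :
      Deriv S C Γ (φ.subst x (.par a) ::ₘ Δ) → Deriv S C Γ (.all x φ ::ₘ Δ)
  | exL {Γ Δ : Multiset (Formula L)} {x : ℕ} {φ : Formula L} (a : ℕ)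
      (hΓ : Fresh a Γ) (hΔ : Fresh a Δ) (hφ : ¬ φ.HasPar a) :
      Deriv S C (φ.subst x (.par a) ::ₘ Γ) Δ → Deriv S C (.ex x φ ::ₘ Γ) Δ
  | exR {Γ Δ : Multiset (Formula L)} {x : ℕ} {φ : Formula L} (b : Name L) :
      Deriv S C Γ (φ.subst x b ::ₘ Δ) → Deriv S C Γ (.ex x φ ::ₘ Δ)
  | eqPlus {Γ Δ : Multiset (Formula L)} (b : Name L) :
      Deriv S C (.eq (.name b) (.name b) ::ₘ Γ) Δ → Deriv S C Γ Δ
  | eqMinus {Γ Δ : Multiset (Formula L)} {x : ℕ} {φ : Formula L} (b c : Name L)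
      (hφ : φ.IsAtomic) :
      Deriv S C (φ.subst x c ::ₘ Γ) Δ →
      Deriv S C (.eq (.name b) (.name c) ::ₘ φ.subst x b ::ₘ Γ) Δ
  | lamL {Γ Δ : Multiset (Formula L)} {x : ℕ} {ψ : Formula L} (b : Name L) :
      Deriv S C (ψ.subst x b ::ₘ Γ) Δ → Deriv S C (.lam x ψ (.name b) ::ₘ Γ) Δ
  | lamR {Γ Δ : Multiset (Formula L)} {x : ℕ} {ψ : Formula L} (b : Name L) :
      Deriv S C Γ (ψ.subst x b ::ₘ Δ) → Deriv S C Γ (.lam x ψ (.name b) ::ₘ Δ)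
  | iotaL₁ {Γ Δ : Multiset (Formula L)} {x y : ℕ} {φ ψ : Formula L} (a : ℕ)
      (hΓ : Fresh a Γ) (hΔ : Fresh a Δ) (hφ : ¬ φ.HasPar a) (hψ : ¬ ψ.HasPar a) :
      Deriv S C (φ.subst y (.par a) ::ₘ ψ.subst x (.par a) ::ₘ Γ) Δ →
      Deriv S C (.lamIota x ψ y φ ::ₘ Γ) Δ
  | iotaL₂ {Γ Δ : Multiset (Formula L)} {x y : ℕ} {φ ψ : Formula L} (b c : Name L)
      (h : (Formula.lamIota x ψ y φ).Closed) :
      Deriv S C Γ (φ.subst y b ::ₘ Δ) → Deriv S C Γ (φ.subst y c ::ₘ Δ) →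
      Deriv S C (.eq (.name b) (.name c) ::ₘ Γ) Δ →
      Deriv S C (.lamIota x ψ y φ ::ₘ Γ) Δ
  | iotaR {Γ Δ : Multiset (Formula L)} {x y : ℕ} {φ ψ : Formula L} (b : Name L) (a : ℕ)
      (hΓ : Fresh a Γ) (hΔ : Fresh a Δ) (hφ : ¬ φ.HasPar a) (hψ : ¬ ψ.HasPar a)
      (hb : b ≠ .par a) :
      Deriv S C Γ (φ.subst y b ::ₘ Δ) → Deriv S C Γ (ψ.subst x b ::ₘ Δ) →
      Deriv S C (φ.subst y (.par a) ::ₘ Γ) (.eq (.name (.par a)) (.name b) ::ₘ Δ) →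
      Deriv S C Γ (.lamIota x ψ y φ ::ₘ Δ)
  | relEqL {Γ Δ : Multiset (Formula L)} {n : ℕ+} {A B : RelName L n} (b : Fin n → Name L) :
      Deriv S C Γ (.rel (.name A) (fun i => .name (b i)) ::ₘ
        .rel (.name B) (fun i => .name (b i)) ::ₘ Δ) →
      Deriv S C (.rel (.name A) (fun i => .name (b i)) ::ₘ
        .rel (.name B) (fun i => .name (b i)) ::ₘ Γ) Δ →
      Deriv S C (.relEq (.name A) (.name B) ::ₘ Γ) Δ
  | relEqR {Γ Δ : Multiset (Formula L)} {n : ℕ+} {A B : RelName L n} (a : Fin n → ℕ)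
      (ha : Function.Injective a) (hΓ : ∀ i, Fresh (a i) Γ) (hΔ : ∀ i, Fresh (a i) Δ) :
      Deriv S C (.rel (.name A) (fun i => .name (.par (a i))) ::ₘ Γ)
        (.rel (.name B) (fun i => .name (.par (a i))) ::ₘ Δ) →
      Deriv S C (.rel (.name B) (fun i => .name (.par (a i))) ::ₘ Γ)
        (.rel (.name A) (fun i => .name (.par (a i))) ::ₘ Δ) →
      Deriv S C Γ (.relEq (.name A) (.name B) ::ₘ Δ)
  | all2L {Γ Δ : Multiset (Formula L)} {n : ℕ+} {X : ℕ} {φ : Formula L} (B : RelName L n) :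
      Deriv S C (φ.substRel n X B ::ₘ Γ) Δ → Deriv S C (.all2 n X φ ::ₘ Γ) Δ
  | all2R {Γ Δ : Multiset (Formula L)} {n : ℕ+} {X : ℕ} {φ : Formula L} (A : ℕ)
      (hΓ : FreshRel n A Γ) (hΔ : FreshRel n A Δ) (hφ : ¬ φ.HasRelPar n A) :
      Deriv S C Γ (φ.substRel n X (.par A) ::ₘ Δ) → Deriv S C Γ (.all2 n X φ ::ₘ Δ)
  | ex2L {Γ Δ : Multiset (Formula L)} {n : ℕ+} {X : ℕ} {φ : Formula L} (A : ℕ)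
      (hΓ : FreshRel n A Γ) (hΔ : FreshRel n A Δ) (hφ : ¬ φ.HasRelPar n A) :
      Deriv S C (φ.substRel n X (.par A) ::ₘ Γ) Δ → Deriv S C (.ex2 n X φ ::ₘ Γ) Δ
  | ex2R {Γ Δ : Multiset (Formula L)} {n : ℕ+} {X : ℕ} {φ : Formula L} (B : RelName L n) :
      Deriv S C Γ (φ.substRel n X B ::ₘ Δ) → Deriv S C Γ (.ex2 n X φ ::ₘ Δ)
  | iota2L₁ {Γ Δ : Multiset (Formula L)} {n : ℕ+} {X Y : ℕ} {φ ψ : Formula L} (A : ℕ)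
      (hΓ : FreshRel n A Γ) (hΔ : FreshRel n A Δ)
      (hφ : ¬ φ.HasRelPar n A) (hψ : ¬ ψ.HasRelPar n A) :
      Deriv S C (φ.substRel n Y (.par A) ::ₘ ψ.substRel n X (.par A) ::ₘ Γ) Δ →
      Deriv S C (.lamIota2 n X ψ Y φ ::ₘ Γ) Δ
  | iota2L₂ {Γ Δ : Multiset (Formula L)} {n : ℕ+} {X Y : ℕ} {φ ψ : Formula L}
      (B B' : RelName L n) (h : (Formula.lamIota2 n X ψ Y φ).Closed) :
      Deriv S C Γ (φ.substRel n Y B ::ₘ Δ) → Deriv S C Γ (φ.substRel n Y B' ::ₘ Δ) →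
      Deriv S C (.relEq (.name B) (.name B') ::ₘ Γ) Δ →
      Deriv S C (.lamIota2 n X ψ Y φ ::ₘ Γ) Δ
  | iota2R {Γ Δ : Multiset (Formula L)} {n : ℕ+} {X Y : ℕ} {φ ψ : Formula L}
      (B : RelName L n) (A : ℕ)
      (hΓ : FreshRel n A Γ) (hΔ : FreshRel n A Δ)
      (hφ : ¬ φ.HasRelPar n A) (hψ : ¬ ψ.HasRelPar n A) (hB : B ≠ .par A) :
      Deriv S C Γ (φ.substRel n Y B ::ₘ Δ) → Deriv S C Γ (ψ.substRel n X B ::ₘ Δ) →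
      Deriv S C (φ.substRel n Y (.par A) ::ₘ Γ) (.relEq (.name (.par A)) (.name B) ::ₘ Δ) →
      Deriv S C Γ (.lamIota2 n X ψ Y φ ::ₘ Δ)

/-- `H` is derivable from `S` with all cuts on formulas that belong to (some sequent of) `S`. -/
def DerivableCF (S : Set (Sequent L)) (H : Sequent L) : Prop :=
  Deriv S {φ | ∃ s ∈ S, s.Has φ} H.ant H.suc

end RLL

namespace RLL

variable {L : Signature}

/-! ### Countability of the language -/

/-! The proof is by contraposition: a nonderivable sequent is refuted in a term model. The
nonderivable closed sequents are ordered by inclusion of their sides. Since the language is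
countable, there is a directed family of them that contains `H` and meets countably many prescribed
cofinal sets (`exists_decides`). The unions `Γ` and `Δ` of the two sides have no derivable finite
part and are as large, and as rich in witnesses, as this permits (`Saturated`).

With cut restricted, a formula may well belong to neither `Γ` nor `Δ`. Maximality is therefore used
in this form: if a sequent is not within `(Γ, Δ)`, then adding it to any sufficiently large finite
part gives a derivable sequent. The premises of a rule then become derivable over one common finite
part, so the rule derives its conclusion there. Thus, if a principal formula is present, the active
formulas of some premise are present too. For an eigenvariable rule all instances of the premise are
treated at once, so the parameter can be chosen fresh for the finite part after that part is fixed.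
Cut serves only in `Saturated.hyp`: it puts some antecedent formula of each sequent of `S` into `Δ`,
or some succedent formula into `Γ`.

In the term model individuals are names modulo the equations in `Γ`, and the relations of arity `n`
are exactly those denoted by `n`-ary names. General models obey no comprehension, so this small
supply suffices; the rules for `=` between relations match extensional equality of the denoted sets.
By induction on size, formulas of `Γ` are true and those of `Δ` false (`Saturated.truth`). Two
one-way implications are enough: `H` fails, and each sequent of `S` holds by `Saturated.hyp`.

This concerns assignments that evaluate parameters as themselves. For global entailment, every
object of the term model has a name, so any assignment is such a canonical one composed with a
substitution of names for parameters. Closure of `S` under substitution then makes `S` hold under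
all assignments. -/

def Name.equivSum : Name L ≃ ℕ ⊕ L.Con where
  toFun | .par a => .inl a | .con k => .inr k
  invFun | .inl a => .par a | .inr k => .con k
  left_inv b := by cases b <;> rfl
  right_inv b := by cases b <;> rfl

def Term.equivSum : Term L ≃ ℕ ⊕ Name L where
  toFun | .var x => .inl x | .name b => .inr b
  invFun | .inl x => .var x | .inr b => .name b
  left_inv t := by cases t <;> rfl
  right_inv t := by cases t <;> rfl

def RelName.equivSum (n : ℕ+) : RelName L n ≃ ℕ ⊕ L.RelCon n where
  toFun | .par a => .inl a | .con k => .inr k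
  invFun | .inl a => .par a | .inr k => .con k
  left_inv b := by cases b <;> rfl
  right_inv b := by cases b <;> rfl

def RelTerm.equivSum (n : ℕ+) : RelTerm L n ≃ ℕ ⊕ RelName L n where
  toFun | .var x => .inl x | .name b => .inr b
  invFun | .inl x => .var x | .inr b => .name b
  left_inv t := by cases t <;> rfl
  right_inv t := by cases t <;> rfl

instance [Countable L.Con] : Countable (Name L) := Name.equivSum.injective.countable

instance [Countable L.Con] : Countable (Term L) := Term.equivSum.injective.countable

instance (n : ℕ+) [Countable (L.RelCon n)] : Countable (RelName L n) :=
  (RelName.equivSum n).injective.countable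

instance (n : ℕ+) [Countable (L.RelCon n)] : Countable (RelTerm L n) :=
  (RelTerm.equivSum n).injective.countable

/-- A numerical code of a formula, relative to codes of the atomic formulas. -/
def Formula.code (e : Term L × Term L → ℕ)
    (p : (Σ n : ℕ, L.Pred n × (Fin n → Term L)) → ℕ)
    (q : (Σ n : ℕ+, RelTerm L n × RelTerm L n) → ℕ)
    (r : (Σ n : ℕ+, RelTerm L n × (Fin n → Term L)) → ℕ) : Formula L → ℕ
  | .eq t s => Nat.pair 0 (e (t, s))
  | .pred P ts => Nat.pair 1 (p ⟨_, P, ts⟩)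
  | .relEq X Y => Nat.pair 2 (q ⟨_, X, Y⟩)
  | .rel X ts => Nat.pair 3 (r ⟨_, X, ts⟩)
  | .neg φ => Nat.pair 4 (φ.code e p q r)
  | .and φ ψ => Nat.pair 5 (Nat.pair (φ.code e p q r) (ψ.code e p q r))
  | .or φ ψ => Nat.pair 6 (Nat.pair (φ.code e p q r) (ψ.code e p q r))
  | .imp φ ψ => Nat.pair 7 (Nat.pair (φ.code e p q r) (ψ.code e p q r))
  | .iff φ ψ => Nat.pair 8 (Nat.pair (φ.code e p q r) (ψ.code e p q r))
  | .all x φ => Nat.pair 9 (Nat.pair x (φ.code e p q r))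
  | .ex x φ => Nat.pair 10 (Nat.pair x (φ.code e p q r))
  -- `e` codes pairs of terms; a single term is coded by its diagonal pair.
  | .lam x ψ t => Nat.pair 11 (Nat.pair x (Nat.pair (ψ.code e p q r) (e (t, t))))
  | .lamIota x ψ y φ =>
      Nat.pair 12 (Nat.pair x (Nat.pair (ψ.code e p q r) (Nat.pair y (φ.code e p q r))))
  | .all2 n X φ => Nat.pair 13 (Nat.pair n (Nat.pair X (φ.code e p q r)))
  | .ex2 n X φ => Nat.pair 14 (Nat.pair n (Nat.pair X (φ.code e p q r)))
  | .lamIota2 n X ψ Y φ =>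
      Nat.pair 15 (Nat.pair n
        (Nat.pair X (Nat.pair (ψ.code e p q r) (Nat.pair Y (φ.code e p q r)))))

theorem Formula.code_injective {e : Term L × Term L → ℕ}
    {p : (Σ n : ℕ, L.Pred n × (Fin n → Term L)) → ℕ}
    {q : (Σ n : ℕ+, RelTerm L n × RelTerm L n) → ℕ}
    {r : (Σ n : ℕ+, RelTerm L n × (Fin n → Term L)) → ℕ}
    (he : e.Injective) (hp : p.Injective) (hq : q.Injective) (hr : r.Injective) :
    (Formula.code e p q r).Injective := by
  intro φ
  induction φ with
  | eq t s =>
      intro χ h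
      cases χ <;> simp [code, Nat.pair_eq_pair] at h
      simpa using he h
  | pred P ts =>
      intro χ h
      cases χ <;> simp [code, Nat.pair_eq_pair] at h
      cases hp h
      rfl
  | relEq X Y =>
      intro χ h
      cases χ <;> simp [code, Nat.pair_eq_pair] at h
      cases hq h
      rfl
  | rel X ts =>
      intro χ h
      cases χ <;> simp [code, Nat.pair_eq_pair] at h
      cases hr h
      rfl
  | neg φ ih | all x φ ih | ex x φ ih | all2 n X φ ih | ex2 n X φ ih =>
      intro χ h
      cases χ <;> simp [code, Nat.pair_eq_pair] at h
      grind
  | and φ ψ ih₁ ih₂ | or φ ψ ih₁ ih₂ | imp φ ψ ih₁ ih₂ | iff φ ψ ih₁ ih₂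
  | lamIota x ψ y φ ih₁ ih₂ | lamIota2 n X ψ Y φ ih₁ ih₂ =>
      intro χ h
      cases χ <;> simp [code, Nat.pair_eq_pair] at h
      grind
  | lam x ψ t ih =>
      intro χ h
      cases χ <;> simp [code, Nat.pair_eq_pair] at h
      have := he h.2.2
      grind

instance [Countable L.Con] [∀ n, Countable (L.Pred n)] [∀ n, Countable (L.RelCon n)] :
    Countable (Formula L) := by
  obtain ⟨e, he⟩ := exists_injective_nat (Term L × Term L)
  obtain ⟨p, hp⟩ := exists_injective_nat (Σ n : ℕ, L.Pred n × (Fin n → Term L))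
  obtain ⟨q, hq⟩ := exists_injective_nat (Σ n : ℕ+, RelTerm L n × RelTerm L n)
  obtain ⟨r, hr⟩ := exists_injective_nat (Σ n : ℕ+, RelTerm L n × (Fin n → Term L))
  exact (Formula.code_injective he hp hq hr).countable

/-! ### Free variables, parameters and size under substitution -/

/-- The number of logical operators of a formula. -/
def Formula.size : Formula L → ℕ
  | .eq _ _ | .pred _ _ | .relEq _ _ | .rel _ _ => 0
  | .neg φ | .all _ φ | .ex _ φ | .lam _ φ _ | .all2 _ _ φ | .ex2 _ _ φ => φ.size + 1
  | .and φ ψ | .or φ ψ | .imp φ ψ | .iff φ ψ | .lamIota _ φ _ ψ | .lamIota2 _ _ φ _ ψ =>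
      φ.size + ψ.size + 1

@[simp] theorem Formula.size_subst (x : ℕ) (b : Name L) (φ : Formula L) :
    (φ.subst x b).size = φ.size := by
  induction φ <;> simp only [subst, size] <;> grind

@[simp] theorem Formula.size_substRel (n : ℕ+) (X : ℕ) (B : RelName L n) (φ : Formula L) :
    (φ.substRel n X B).size = φ.size := by
  induction φ <;> simp only [substRel, size] <;> grind

theorem Term.hasVar_subst {x z : ℕ} {b : Name L} {t : Term L} :
    (t.subst x b).HasVar z ↔ z ≠ x ∧ t.HasVar z := by
  cases t <;> simp only [subst, HasVar] <;> grind [HasVar]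

theorem RelTerm.hasVar_subst {n m k : ℕ+} {X Z : ℕ} {B : RelName L n} {U : RelTerm L k} :
    (U.subst n X B).HasVar m Z ↔ ¬ (n = m ∧ X = Z) ∧ U.HasVar m Z := by
  cases U <;> simp only [subst, HasVar] <;> grind [HasVar]

/-- A name contains no variable, so substitution removes `x` and adds nothing. In particular, the
free variables of an instance do not depend on the name chosen. -/
theorem Formula.hasFree_subst {x z : ℕ} {b : Name L} {φ : Formula L} :
    (φ.subst x b).HasFree z ↔ z ≠ x ∧ φ.HasFree z := by
  induction φ <;> simp only [subst, HasFree, Term.hasVar_subst] <;> grind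

theorem Formula.hasFreeRel_subst {x : ℕ} {b : Name L} {m : ℕ+} {Z : ℕ} {φ : Formula L} :
    (φ.subst x b).HasFreeRel m Z ↔ φ.HasFreeRel m Z := by
  induction φ <;> simp only [subst, HasFreeRel] <;> grind

theorem Formula.hasFree_substRel {n : ℕ+} {X z : ℕ} {B : RelName L n} {φ : Formula L} :
    (φ.substRel n X B).HasFree z ↔ φ.HasFree z := by
  induction φ <;> simp only [substRel, HasFree] <;> grind

theorem Formula.hasFreeRel_substRel {n m : ℕ+} {X Z : ℕ} {B : RelName L n} {φ : Formula L} :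
    (φ.substRel n X B).HasFreeRel m Z ↔ ¬ (n = m ∧ X = Z) ∧ φ.HasFreeRel m Z := by
  induction φ <;> simp only [substRel, HasFreeRel, RelTerm.hasVar_subst] <;> grind

/-- Substituting for `x` closes a formula in which at most `x` is free. -/
theorem Formula.closed_subst {x : ℕ} {φ : Formula L} (h : ∀ z, x ≠ z → ¬ φ.HasFree z)
    (h' : ∀ m Z, ¬ φ.HasFreeRel m Z) (b : Name L) : (φ.subst x b).Closed :=
  ⟨fun z hz => by
    rw [hasFree_subst] at hz
    exact h z hz.1.symm hz.2, fun m Z hZ => h' m Z (hasFreeRel_subst.1 hZ)⟩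

/-- Substituting for `X` closes a formula in which at most `X` is free. -/
theorem Formula.closed_substRel {n : ℕ+} {X : ℕ} {φ : Formula L} (h : ∀ z, ¬ φ.HasFree z)
    (h' : ∀ m Z, ¬ (n = m ∧ X = Z) → ¬ φ.HasFreeRel m Z) (B : RelName L n) :
    (φ.substRel n X B).Closed :=
  ⟨fun z hz => h z (hasFree_substRel.1 hz), fun m Z hZ => by
    rw [hasFreeRel_substRel] at hZ
    exact h' m Z hZ.1 hZ.2⟩

theorem Term.finite_hasPar (t : Term L) : {a | t.HasPar a}.Finite := by
  rcases t with x | ⟨a⟩ | k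
  · simp [HasPar]
  · simp [HasPar]
  · simp [HasPar]

theorem RelTerm.finite_hasPar (m : ℕ+) {n : ℕ+} (U : RelTerm L n) :
    {A | U.HasPar m A}.Finite := by
  rcases U with X | ⟨A⟩ | K
  · simp [HasPar]
  · exact (Set.finite_singleton A).subset fun A' h => h.2.symm
  · simp [HasPar]

/-- This finiteness, against infinitely many parameters, is what supplies eigenvariables. -/
theorem Formula.finite_hasPar (φ : Formula L) : {a | φ.HasPar a}.Finite := by
  induction φ with
  | pred P ts => simpa [HasPar, Set.ofPred_exists] using
      Set.finite_iUnion fun i => (ts i).finite_hasPar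
  | rel X ts => simpa [HasPar, Set.ofPred_exists] using
      Set.finite_iUnion fun i => (ts i).finite_hasPar
  | _ => simp_all [HasPar, Set.ofPred_or, Term.finite_hasPar]

theorem Formula.finite_hasRelPar (m : ℕ+) (φ : Formula L) : {A | φ.HasRelPar m A}.Finite := by
  induction φ <;> simp_all [HasRelPar, Set.ofPred_or, RelTerm.finite_hasPar]

theorem finite_not_fresh (Γ : Multiset (Formula L)) : {a | ¬ Fresh a Γ}.Finite := by
  have : {a | ¬ Fresh a Γ} = ⋃ χ ∈ {χ | χ ∈ Γ}, {a | χ.HasPar a} := by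
    ext a; simp [Fresh]
  rw [this]
  exact Set.Finite.biUnion (Multiset.finite_toSet Γ) fun χ _ => χ.finite_hasPar

theorem finite_not_freshRel (n : ℕ+) (Γ : Multiset (Formula L)) :
    {A | ¬ FreshRel n A Γ}.Finite := by
  have : {A | ¬ FreshRel n A Γ} = ⋃ χ ∈ {χ | χ ∈ Γ}, {A | χ.HasRelPar n A} := by
    ext a; simp [FreshRel]
  rw [this]
  exact Set.Finite.biUnion (Multiset.finite_toSet Γ) fun χ _ => χ.finite_hasRelPar n

/-- Outside a finite set there are fresh individual parameters. -/
theorem exists_fresh (Γ : Multiset (Formula L)) {s : Set ℕ} (hs : s.Finite) :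
    ∃ a ∉ s, Fresh a Γ := by
  obtain ⟨a, ha⟩ := (hs.union (finite_not_fresh Γ)).exists_notMem
  simp only [Set.mem_union, Set.mem_ofPred_eq, not_or, not_not] at ha
  exact ⟨a, ha⟩

/-- Outside a finite set there are fresh relational parameters. -/
theorem exists_freshRel (n : ℕ+) (Γ : Multiset (Formula L)) {s : Set ℕ} (hs : s.Finite) :
    ∃ A ∉ s, FreshRel n A Γ := by
  obtain ⟨a, ha⟩ := (hs.union (finite_not_freshRel n Γ)).exists_notMem
  simp only [Set.mem_union, Set.mem_ofPred_eq, not_or, not_not] at ha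
  exact ⟨a, ha⟩

/-- There are arbitrarily long tuples of distinct fresh individual parameters. -/
theorem exists_injective_fresh (n : ℕ) (Γ : Multiset (Formula L)) :
    ∃ a : Fin n → ℕ, a.Injective ∧ ∀ i, Fresh (a i) Γ := by
  have e := (finite_not_fresh Γ).infinite_compl.natEmbedding
  refine ⟨fun i => e i, fun i j h => Fin.ext (e.injective (Subtype.ext h)), fun i => ?_⟩
  have h : ¬ ¬ Fresh (e i : ℕ) Γ := (e i).2
  exact not_not.1 h

/-! ### Satisfaction under substitution -/

namespace Assignment

variable {M : GeneralModel L}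

theorem update_update_self (v : Assignment M) (x : ℕ) (o o' : M.D) :
    (v.update x o).update x o' = v.update x o' := by simp [update]

theorem update_update_comm (v : Assignment M) {x y : ℕ} (h : y ≠ x) (o o' : M.D) :
    (v.update x o).update y o' = (v.update y o').update x o := by
  simp [update, Function.update_comm h]

theorem update_updateRel (v : Assignment M) (x : ℕ) (o : M.D) (n : ℕ+) (X : ℕ) (O : M.G n) :
    (v.update x o).updateRel n X O = (v.updateRel n X O).update x o := rfl

theorem updateRel_relVar (v : Assignment M) (n : ℕ+) (X : ℕ) (O : M.G n) (m : ℕ+) (Y : ℕ) :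
    (v.updateRel n X O).relVar m Y =
      if h : n = m then (if Y = X then h ▸ O else v.relVar m Y) else v.relVar m Y := by
  by_cases h : n = m
  · subst h
    simp [updateRel, Function.update_apply]
  · simp [updateRel, Function.update_of_ne (Ne.symm h), h]

theorem updateRel_updateRel_self (v : Assignment M) (n : ℕ+) (X : ℕ) (O O' : M.G n) :
    (v.updateRel n X O).updateRel n X O' = v.updateRel n X O' := by simp [updateRel]

/-- A relational variable is a pair of arity and index. The two updates can interact only at a
common arity, and there the hypothesis separates the indices. -/
theorem updateRel_updateRel_comm (v : Assignment M) {n m : ℕ+} {X Y : ℕ}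
    (h : ¬ (m = n ∧ Y = X)) (O : M.G n) (O' : M.G m) :
    (v.updateRel n X O).updateRel m Y O' = (v.updateRel m Y O').updateRel n X O := by
  have : ((v.updateRel n X O).updateRel m Y O').relVar =
      ((v.updateRel m Y O').updateRel n X O).relVar := by
    funext k Z
    simp only [updateRel_relVar]
    by_cases h₁ : m = k
    · by_cases h₂ : n = k
      · subst h₁ h₂
        grind
      · simp [h₂]
    · simp [h₁]
  simpa [updateRel] using this

theorem term_subst (v : Assignment M) (x : ℕ) (b : Name L) (t : Term L) :
    v.term (t.subst x b) = (v.update x (v.term (.name b))).term t := by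
  rcases t with y | ⟨a⟩ | k
  · by_cases h : y = x <;> simp [Term.subst, term, update, h]
  · rfl
  · rfl

theorem relTerm_subst (v : Assignment M) (n : ℕ+) (X : ℕ) (B : RelName L n) {m : ℕ+}
    (U : RelTerm L m) :
    v.relTerm (U.subst n X B) = (v.updateRel n X (v.relTerm (.name B))).relTerm U := by
  rcases U with Y | ⟨A⟩ | K
  · by_cases h : n = m
    · subst h
      by_cases h : Y = X <;> simp [RelTerm.subst, h] <;>
        simp [relTerm, updateRel_relVar, h]
    · simp [RelTerm.subst, relTerm, updateRel_relVar, h]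
  · rfl
  · rfl

end Assignment

open Assignment

/-- No capture condition is needed because the value of a name ignores the variables: `hn` and `hr`
carry it unchanged under every binder. -/
theorem sat_subst {M : GeneralModel L} (x : ℕ) (b : Name L) (φ : Formula L)
    (v : Assignment M) :
    Sat M v (φ.subst x b) ↔ Sat M (v.update x (v.term (.name b))) φ := by
  have hn : ∀ (v : Assignment M) y o, (v.update y o).term (.name b) = v.term (.name b) := by
    intro v y o; cases b <;> rfl
  have hr : ∀ (v : Assignment M) n Y O, (v.updateRel n Y O).term (.name b) = v.term (.name b) := by
    intro v n y o; cases b <;> rfl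
  -- Under a binder for `z`: if `z = x`, the inner update overwrites the outer one and nothing is
  -- substituted; otherwise the two updates commute.
  have key : ∀ (χ : Formula L) (z : ℕ) (o : M.D) (v : Assignment M),
      (∀ v : Assignment M, Sat M v (χ.subst x b) ↔ Sat M (v.update x (v.term (.name b))) χ) →
      (Sat M (v.update z o) (if z = x then χ else χ.subst x b) ↔
        Sat M ((v.update x (v.term (.name b))).update z o) χ) := by
    intro χ z o v ih
    split_ifs with h
    · rw [h, update_update_self]
    · rw [ih, hn, update_update_comm _ h]
  induction φ generalizing v with
  | eq t s => simp [Formula.subst, Sat, term_subst]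
  | pred P ts => simp [Formula.subst, Sat, term_subst]
  | relEq X Y => rfl
  | rel X ts =>
      simp only [Formula.subst, Sat, term_subst]
      rfl
  | neg φ ih => simp [Formula.subst, Sat, ih]
  | and φ ψ ih₁ ih₂ | or φ ψ ih₁ ih₂ | imp φ ψ ih₁ ih₂ | iff φ ψ ih₁ ih₂ =>
      simp [Formula.subst, Sat, ih₁, ih₂]
  | all z φ ih | ex z φ ih => simp only [Formula.subst, Sat, key _ _ _ _ ih]
  | lam z ψ t ih => simp only [Formula.subst, Sat, key _ _ _ _ ih, term_subst]
  | lamIota z ψ y φ ih₁ ih₂ =>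
      simp only [Formula.subst, Sat, key _ _ _ _ ih₁, key _ _ _ _ ih₂]
  | all2 n X φ ih | ex2 n X φ ih =>
      simp only [Formula.subst, Sat, ih, hr, update_updateRel]
  | lamIota2 n X ψ Y φ ih₁ ih₂ =>
      simp only [Formula.subst, Sat, ih₁, ih₂, hr, update_updateRel]

theorem sat_substRel {M : GeneralModel L} (n : ℕ+) (X : ℕ) (B : RelName L n) (φ : Formula L)
    (v : Assignment M) :
    Sat M v (φ.substRel n X B) ↔ Sat M (v.updateRel n X (v.relTerm (.name B))) φ := by
  have hn : ∀ (v : Assignment M) y o,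
      (v.update y o).relTerm (.name B) = v.relTerm (.name B) := by
    intro v y o; cases B <;> rfl
  have hr : ∀ (v : Assignment M) n Y O,
      (v.updateRel n Y O).relTerm (.name B) = v.relTerm (.name B) := by
    intro v n y o; cases B <;> rfl
  have ht : ∀ (v : Assignment M) n Y O (t : Term L), (v.updateRel n Y O).term t = v.term t := by
    intro v n y o t; rcases t with _ | _ | _ <;> rfl
  have key : ∀ (χ : Formula L) (m : ℕ+) (Z : ℕ) (O : M.G m) (v : Assignment M),
      (∀ v : Assignment M, Sat M v (χ.substRel n X B) ↔
        Sat M (v.updateRel n X (v.relTerm (.name B))) χ) →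
      (Sat M (v.updateRel m Z O) (if m = n ∧ Z = X then χ else χ.substRel n X B) ↔
        Sat M ((v.updateRel n X (v.relTerm (.name B))).updateRel m Z O) χ) := by
    intro χ m Z O v ih
    split_ifs with h
    · obtain ⟨rfl, rfl⟩ := h
      rw [updateRel_updateRel_self]
    · rw [ih, hr, updateRel_updateRel_comm _ h]
  induction φ generalizing v with
  | eq t s => simp [Formula.substRel, Sat, ht]
  | pred P ts => simp [Formula.substRel, Sat, ht]
  | relEq X Y => simp [Formula.substRel, Sat, relTerm_subst]
  | rel X ts => simp [Formula.substRel, Sat, relTerm_subst, ht]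
  | neg φ ih => simp [Formula.substRel, Sat, ih]
  | and φ ψ ih₁ ih₂ | or φ ψ ih₁ ih₂ | imp φ ψ ih₁ ih₂ | iff φ ψ ih₁ ih₂ =>
      simp [Formula.substRel, Sat, ih₁, ih₂]
  | all z φ ih | ex z φ ih => simp only [Formula.substRel, Sat, ih, hn, update_updateRel]
  | lam z ψ t ih => simp only [Formula.substRel, Sat, ih, hn, ht, update_updateRel]
  | lamIota z ψ y φ ih₁ ih₂ =>
      simp only [Formula.substRel, Sat, ih₁, ih₂, hn, update_updateRel]
  | all2 m Z φ ih | ex2 m Z φ ih => simp only [Formula.substRel, Sat, key _ _ _ _ _ ih]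
  | lamIota2 m Z ψ Y φ ih₁ ih₂ =>
      simp only [Formula.substRel, Sat, key _ _ _ _ _ ih₁, key _ _ _ _ _ ih₂]

/-- The assignment that evaluates a parameter as `v` evaluates the name substituted for it. -/
def Assignment.comp {M : GeneralModel L} (v : Assignment M) (σ : ParSubst L) : Assignment M :=
  { v with
    par := fun a => v.term (.name (σ.ind a))
    relPar := fun n A => v.relTerm (.name (σ.rel n A)) }

theorem Assignment.term_parSubst {M : GeneralModel L} (v : Assignment M) (σ : ParSubst L)
    (t : Term L) : v.term (t.parSubst σ) = (v.comp σ).term t := by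
  rcases t with _ | _ | _ <;> rfl

theorem Assignment.relTerm_parSubst {M : GeneralModel L} (v : Assignment M) (σ : ParSubst L)
    {n : ℕ+} (U : RelTerm L n) : v.relTerm (U.parSubst σ) = (v.comp σ).relTerm U := by
  rcases U with _ | _ | _ <;> rfl

theorem Assignment.comp_update {M : GeneralModel L} (v : Assignment M) (σ : ParSubst L)
    (x : ℕ) (o : M.D) : (v.update x o).comp σ = (v.comp σ).update x o := by
  have h₁ : ∀ b : Name L, (v.update x o).term (.name b) = v.term (.name b) := by
    intro b; cases b <;> rfl
  have h₂ : ∀ (n : ℕ+) (B : RelName L n),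
      (v.update x o).relTerm (.name B) = v.relTerm (.name B) := by
    intro n B; cases B <;> rfl
  simp only [comp, h₁, h₂]
  rfl

theorem Assignment.comp_updateRel {M : GeneralModel L} (v : Assignment M) (σ : ParSubst L)
    (n : ℕ+) (X : ℕ) (O : M.G n) :
    (v.updateRel n X O).comp σ = (v.comp σ).updateRel n X O := by
  have h₁ : ∀ b : Name L, (v.updateRel n X O).term (.name b) = v.term (.name b) := by
    intro b; cases b <;> rfl
  have h₂ : ∀ (m : ℕ+) (B : RelName L m),
      (v.updateRel n X O).relTerm (.name B) = v.relTerm (.name B) := by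
    intro m B; cases B <;> rfl
  simp only [comp, h₁, h₂]
  rfl

/-- Only names are substituted, and their values ignore variables, so composition with `σ` commutes
with the updates made by binders. -/
theorem sat_parSubst {M : GeneralModel L} (σ : ParSubst L) (φ : Formula L) (v : Assignment M) :
    Sat M v (φ.parSubst σ) ↔ Sat M (v.comp σ) φ := by
  induction φ generalizing v <;>
    simp_all [Formula.parSubst, Sat, term_parSubst, relTerm_parSubst, comp_update,
      comp_updateRel]

theorem Sequent.holds_parSubst {M : GeneralModel L} (σ : ParSubst L) (H : Sequent L)
    (v : Assignment M) : (H.parSubst σ).Holds M v ↔ H.Holds M (v.comp σ) := by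
  simp [Holds, parSubst, sat_parSubst]

/-! ### Closed compound formulas -/

namespace Formula

theorem closed_neg {φ : Formula L} : (neg φ).Closed ↔ φ.Closed := Iff.rfl

theorem closed_and {φ ψ : Formula L} : (and φ ψ).Closed ↔ φ.Closed ∧ ψ.Closed := by
  simp only [Closed, HasFree, HasFreeRel]; grind

theorem closed_or {φ ψ : Formula L} : (or φ ψ).Closed ↔ φ.Closed ∧ ψ.Closed := closed_and

theorem closed_imp {φ ψ : Formula L} : (imp φ ψ).Closed ↔ φ.Closed ∧ ψ.Closed := closed_and

theorem closed_iff {φ ψ : Formula L} : (iff φ ψ).Closed ↔ φ.Closed ∧ ψ.Closed := closed_and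

theorem Closed.of_all {x : ℕ} {φ : Formula L} (h : (all x φ).Closed) (b : Name L) :
    (φ.subst x b).Closed :=
  closed_subst (fun z hz hf => h.1 z ⟨hz, hf⟩) h.2 b

theorem Closed.of_ex {x : ℕ} {φ : Formula L} (h : (ex x φ).Closed) (b : Name L) :
    (φ.subst x b).Closed :=
  closed_subst (fun z hz hf => h.1 z ⟨hz, hf⟩) h.2 b

theorem Closed.of_lam {x : ℕ} {ψ : Formula L} {t : Term L} (h : (lam x ψ t).Closed)
    (b : Name L) : (ψ.subst x b).Closed :=
  closed_subst (fun z hz hf => h.1 z (.inl ⟨hz, hf⟩)) h.2 b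

theorem Closed.of_lamIota_left {x y : ℕ} {ψ φ : Formula L} (h : (lamIota x ψ y φ).Closed)
    (b : Name L) : (ψ.subst x b).Closed :=
  closed_subst (fun z hz hf => h.1 z (.inl ⟨hz, hf⟩)) (fun m Z hZ => h.2 m Z (.inl hZ)) b

theorem Closed.of_lamIota_right {x y : ℕ} {ψ φ : Formula L} (h : (lamIota x ψ y φ).Closed)
    (b : Name L) : (φ.subst y b).Closed :=
  closed_subst (fun z hz hf => h.1 z (.inr ⟨hz, hf⟩)) (fun m Z hZ => h.2 m Z (.inr hZ)) b

theorem Closed.of_all2 {n : ℕ+} {X : ℕ} {φ : Formula L} (h : (all2 n X φ).Closed)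
    (B : RelName L n) : (φ.substRel n X B).Closed :=
  closed_substRel (φ := φ) h.1 (fun m Z hZ hf => h.2 m Z ⟨hZ, hf⟩) B

theorem Closed.of_ex2 {n : ℕ+} {X : ℕ} {φ : Formula L} (h : (ex2 n X φ).Closed)
    (B : RelName L n) : (φ.substRel n X B).Closed :=
  closed_substRel (φ := φ) h.1 (fun m Z hZ hf => h.2 m Z ⟨hZ, hf⟩) B

theorem Closed.of_lamIota2_left {n : ℕ+} {X Y : ℕ} {ψ φ : Formula L}
    (h : (lamIota2 n X ψ Y φ).Closed) (B : RelName L n) : (ψ.substRel n X B).Closed :=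
  closed_substRel (fun z hz => h.1 z (.inl hz)) (fun m Z hZ hf => h.2 m Z (.inl ⟨hZ, hf⟩)) B

theorem Closed.of_lamIota2_right {n : ℕ+} {X Y : ℕ} {ψ φ : Formula L}
    (h : (lamIota2 n X ψ Y φ).Closed) (B : RelName L n) : (φ.substRel n Y B).Closed :=
  closed_substRel (fun z hz => h.1 z (.inr hz)) (fun m Z hZ hf => h.2 m Z (.inr ⟨hZ, hf⟩)) B

theorem closed_eq_name (b c : Name L) : (eq (.name b) (.name c)).Closed := by
  simp [Closed, HasFree, HasFreeRel, Term.HasVar]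

theorem closed_relEq_name {n : ℕ+} (A B : RelName L n) :
    (relEq (.name A) (.name B)).Closed := by
  simp [Closed, HasFree, HasFreeRel, RelTerm.HasVar]

theorem closed_rel_name {n : ℕ+} (A : RelName L n) (b : Fin n → Name L) :
    (rel (.name A) fun i => .name (b i)).Closed := by
  simp [Closed, HasFree, HasFreeRel, RelTerm.HasVar, Term.HasVar]

end Formula

theorem Term.exists_name_of_forall_not_hasVar {t : Term L} (h : ∀ z, ¬ t.HasVar z) :
    ∃ b, t = .name b := by
  cases t with
  | var x => exact (h x rfl).elim
  | name b => exact ⟨b, rfl⟩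

theorem RelTerm.exists_name_of_forall_not_hasVar {n : ℕ+} {U : RelTerm L n}
    (h : ∀ m Z, ¬ U.HasVar m Z) : ∃ B, U = .name B := by
  cases U with
  | var X => exact (h n X ⟨rfl, rfl⟩).elim
  | name B => exact ⟨B, rfl⟩

/-! ### Sequents ordered by inclusion of their sides -/

/-- Multiplicities are ignored, which is why this is only a preorder; weakening and contraction make
derivability monotone for it (`Deriv.mono`). -/
instance : Preorder (Sequent L) where
  le T U := T.ant ⊆ U.ant ∧ T.suc ⊆ U.suc
  le_refl _ := ⟨Multiset.Subset.refl _, Multiset.Subset.refl _⟩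
  le_trans _ _ _ h h' := ⟨Multiset.Subset.trans h.1 h'.1, Multiset.Subset.trans h.2 h'.2⟩

instance : Add (Sequent L) := ⟨fun T U => ⟨T.ant + U.ant, T.suc + U.suc⟩⟩

namespace Sequent

theorem le_def {T U : Sequent L} : T ≤ U ↔ T.ant ⊆ U.ant ∧ T.suc ⊆ U.suc := Iff.rfl

@[simp] theorem ant_add (T U : Sequent L) : (T + U).ant = T.ant + U.ant := rfl

@[simp] theorem suc_add (T U : Sequent L) : (T + U).suc = T.suc + U.suc := rfl

theorem le_add_left (T U : Sequent L) : T ≤ U + T :=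
  ⟨fun _ h => Multiset.mem_add.2 (.inr h), fun _ h => Multiset.mem_add.2 (.inr h)⟩

theorem le_add_right (T U : Sequent L) : T ≤ T + U :=
  ⟨fun _ h => Multiset.mem_add.2 (.inl h), fun _ h => Multiset.mem_add.2 (.inl h)⟩

theorem add_le {T U V : Sequent L} (hT : T ≤ V) (hU : U ≤ V) : T + U ≤ V :=
  ⟨fun _ h => (Multiset.mem_add.1 h).elim (fun h => hT.1 h) fun h => hU.1 h,
    fun _ h => (Multiset.mem_add.1 h).elim (fun h => hT.2 h) fun h => hU.2 h⟩

theorem Closed.add {T U : Sequent L} (hT : T.Closed) (hU : U.Closed) : (T + U).Closed := by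
  intro φ h
  simp only [Has, ant_add, suc_add, Multiset.mem_add] at h
  rcases h with (h | h) | (h | h)
  exacts [hT φ (.inl h), hU φ (.inl h), hT φ (.inr h), hU φ (.inr h)]

/-- The left side of the sequent is included in `Γ`, the right side in `Δ`. -/
def Within (T : Sequent L) (Γ Δ : Set (Formula L)) : Prop :=
  (∀ φ ∈ T.ant, φ ∈ Γ) ∧ ∀ φ ∈ T.suc, φ ∈ Δ

theorem Within.add {T U : Sequent L} {Γ Δ : Set (Formula L)} (hT : T.Within Γ Δ)
    (hU : U.Within Γ Δ) : (T + U).Within Γ Δ :=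
  ⟨fun φ h => (Multiset.mem_add.1 h).elim (hT.1 φ) (hU.1 φ),
    fun φ h => (Multiset.mem_add.1 h).elim (hT.2 φ) (hU.2 φ)⟩

instance [Countable (Formula L)] : Countable (Sequent L) :=
  Function.Injective.countable (f := fun T : Sequent L => (T.ant, T.suc)) fun T U h => by
    cases T; cases U; simpa using h

end Sequent

/-! ### Admissibility of structural reasoning -/

namespace Deriv

variable {S : Set (Sequent L)} {C : Set (Formula L)} {Γ Δ : Multiset (Formula L)}

theorem weakening_left (Θ : Multiset (Formula L)) (hΘ : ∀ φ ∈ Θ, φ.Closed)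
    (h : Deriv S C Γ Δ) : Deriv S C (Θ + Γ) Δ := by
  induction Θ using Multiset.induction_on with
  | empty => simpa using h
  | cons φ Θ ih =>
      rw [Multiset.cons_add]
      exact .weakL (hΘ φ (by simp)) (ih fun χ hχ => hΘ χ (by simp [hχ]))

theorem weakening_right (Θ : Multiset (Formula L)) (hΘ : ∀ φ ∈ Θ, φ.Closed)
    (h : Deriv S C Γ Δ) : Deriv S C Γ (Θ + Δ) := by
  induction Θ using Multiset.induction_on with
  | empty => simpa using h
  | cons φ Θ ih =>
      rw [Multiset.cons_add]
      exact .weakR (hΘ φ (by simp)) (ih fun χ hχ => hΘ χ (by simp [hχ]))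

theorem contraction_left (Θ : Multiset (Formula L)) (hΘ : Θ ⊆ Γ)
    (h : Deriv S C (Θ + Γ) Δ) : Deriv S C Γ Δ := by
  induction Θ using Multiset.induction_on with
  | empty => simpa using h
  | cons φ Θ ih =>
      refine ih (fun χ hχ => hΘ (by simp [hχ])) ?_
      obtain ⟨Γ', rfl⟩ := Multiset.exists_cons_of_mem (hΘ (Multiset.mem_cons_self φ Θ))
      rw [Multiset.cons_add, Multiset.add_cons] at h
      rw [Multiset.add_cons]
      exact .contrL h

theorem contraction_right (Θ : Multiset (Formula L)) (hΘ : Θ ⊆ Δ)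
    (h : Deriv S C Γ (Θ + Δ)) : Deriv S C Γ Δ := by
  induction Θ using Multiset.induction_on with
  | empty => simpa using h
  | cons φ Θ ih =>
      refine ih (fun χ hχ => hΘ (by simp [hχ])) ?_
      obtain ⟨Δ', rfl⟩ := Multiset.exists_cons_of_mem (hΘ (Multiset.mem_cons_self φ Θ))
      rw [Multiset.cons_add, Multiset.add_cons] at h
      rw [Multiset.add_cons]
      exact .contrR h

/-- All of `U` is added by weakening, and the then superfluous copy of `T` is contracted into it. -/
theorem mono {T U : Sequent L} (h : Deriv S C T.ant T.suc) (hTU : T ≤ U) (hU : U.Closed) :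
    Deriv S C U.ant U.suc := by
  refine contraction_left T.ant hTU.1 (contraction_right T.suc hTU.2 ?_)
  rw [add_comm T.ant, add_comm T.suc]
  exact weakening_right _ (fun φ hφ => hU φ (.inr hφ))
    (weakening_left _ (fun φ hφ => hU φ (.inl hφ)) h)

/-- If every formula of a sequent of `S` is refuted in the context `Γ ⇒ Δ`, on the side
opposite to its own, then cuts on these formulas yield `Γ ⇒ Δ`. -/
theorem of_hyp {s T : Sequent L} (hs : s ∈ S) (hC : ∀ φ, s.Has φ → φ ∈ C) (hT : T.Closed)
    (hant : ∀ φ ∈ s.ant, Deriv S C T.ant (φ ::ₘ T.suc))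
    (hsuc : ∀ φ ∈ s.suc, Deriv S C (φ ::ₘ T.ant) T.suc) : Deriv S C T.ant T.suc := by
  -- `Θ` holds the formulas still to be cut, `Ξ` the contexts piled up so far. Each cut adds another
  -- copy of `T`; since only `Ξ ≤ T` is recorded, a single use of `mono` at the end removes all the
  -- copies.
  have key₁ : ∀ Θ : Multiset (Formula L), Θ ⊆ s.ant → ∀ Ξ : Sequent L, Ξ ≤ T →
      Deriv S C (Θ + Ξ.ant) (s.suc + Ξ.suc) →
        ∃ Ξ' : Sequent L, Ξ' ≤ T ∧ Deriv S C Ξ'.ant (s.suc + Ξ'.suc) := by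
    intro Θ
    induction Θ using Multiset.induction_on with
    | empty => exact fun _ Ξ hΞ h => ⟨Ξ, hΞ, by simpa using h⟩
    | cons φ Θ ih =>
        intro hΘ Ξ hΞ h
        have hφ : φ ∈ s.ant := hΘ (Multiset.mem_cons_self φ Θ)
        rw [Multiset.cons_add] at h
        have h' := Deriv.cut (hC φ (.inl hφ)) (hant φ hφ) h
        refine ih (fun χ hχ => hΘ (by simp [hχ])) (T + Ξ) (Sequent.add_le le_rfl hΞ) ?_
        rw [Sequent.ant_add, Sequent.suc_add, add_left_comm Θ, add_left_comm s.suc]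
        exact h'
  have key₂ : ∀ Θ : Multiset (Formula L), Θ ⊆ s.suc → ∀ Ξ : Sequent L, Ξ ≤ T →
      Deriv S C Ξ.ant (Θ + Ξ.suc) →
        ∃ Ξ' : Sequent L, Ξ' ≤ T ∧ Deriv S C Ξ'.ant Ξ'.suc := by
    intro Θ
    induction Θ using Multiset.induction_on with
    | empty => exact fun _ Ξ hΞ h => ⟨Ξ, hΞ, by simpa using h⟩
    | cons φ Θ ih =>
        intro hΘ Ξ hΞ h
        have hφ : φ ∈ s.suc := hΘ (Multiset.mem_cons_self φ Θ)
        rw [Multiset.cons_add] at h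
        have h' := Deriv.cut (hC φ (.inr hφ)) h (hsuc φ hφ)
        refine ih (fun χ hχ => hΘ (by simp [hχ])) (Ξ + T) (Sequent.add_le hΞ le_rfl) ?_
        rw [Sequent.ant_add, Sequent.suc_add, ← add_assoc Θ]
        exact h'
  obtain ⟨Ξ, hΞ, h⟩ := key₁ s.ant (Multiset.Subset.refl _) ⟨0, 0⟩ (by simp [Sequent.le_def])
    (by simpa using Deriv.hyp hs)
  obtain ⟨Ξ, hΞ, h⟩ := key₂ s.suc (Multiset.Subset.refl _) Ξ hΞ h
  exact h.mono hΞ hT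

end Deriv

/-! ### Saturated pairs of sets of formulas -/

open Filter

/-- The finite parts of the pair `(Γ, Δ)`. -/
abbrev Part (Γ Δ : Set (Formula L)) := {T : Sequent L // T.Within Γ Δ}

instance (Γ Δ : Set (Formula L)) : Nonempty (Part Γ Δ) := ⟨⟨⟨0, 0⟩, by simp [Sequent.Within]⟩⟩

instance (Γ Δ : Set (Formula L)) : IsDirectedOrder (Part Γ Δ) :=
  ⟨fun T U => ⟨⟨T.1 + U.1, T.2.add U.2⟩, Sequent.le_add_right _ _, Sequent.le_add_left _ _⟩⟩

/-- Some sequent of `F` is within `(Γ, Δ)`, or almost all finite parts of `(Γ, Δ)` become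
derivable by adding any sequent of `F`. -/
def Decides (S : Set (Sequent L)) (C : Set (Formula L)) (Γ Δ : Set (Formula L))
    (F : Set (Sequent L)) : Prop :=
  (∃ T ∈ F, T.Within Γ Δ) ∨
    ∀ᶠ U : Part Γ Δ in atTop, ∀ T ∈ F, T.Closed →
      Deriv S C (T.ant + U.1.ant) (T.suc + U.1.suc)

/-- Every nonderivable sequent extends to a consistent pair of sets of formulas that decides
countably many given families of sequents. -/
theorem exists_decides {S : Set (Sequent L)} {C : Set (Formula L)}
    {H : Sequent L} (hH : H.Closed) (hd : ¬ Deriv S C H.ant H.suc)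
    {𝓕 : Set (Set (Sequent L))} (h𝓕 : 𝓕.Countable) :
    ∃ Γ Δ : Set (Formula L), H.Within Γ Δ ∧ (∀ φ ∈ Γ, φ.Closed) ∧ (∀ φ ∈ Δ, φ.Closed) ∧
      (∀ T : Part Γ Δ, ¬ Deriv S C T.1.ant T.1.suc) ∧ ∀ F ∈ 𝓕, Decides S C Γ Δ F := by
  let P := {T : Sequent L // T.Closed ∧ ¬ Deriv S C T.ant T.suc}
  -- Either `p` already makes all closed members of `F` derivable, or some closed `T ∈ F` can be
  -- added to `p` without making it derivable.
  have hcof : ∀ F : Set (Sequent L), IsCofinal {p : P | (∃ T ∈ F, T ≤ p.1) ∨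
      ∀ T ∈ F, T.Closed → Deriv S C (T.ant + p.1.ant) (T.suc + p.1.suc)} := by
    intro F p
    by_cases h : ∀ T ∈ F, T.Closed → Deriv S C (T.ant + p.1.ant) (T.suc + p.1.suc)
    · exact ⟨p, .inr h, le_rfl⟩
    · push Not at h
      obtain ⟨T, hT, hTc, hTd⟩ := h
      exact ⟨⟨T + p.1, hTc.add p.2.1, hTd⟩, .inl ⟨T, hT, Sequent.le_add_right _ _⟩,
        Sequent.le_add_left _ _⟩
  have := h𝓕.to_subtype
  have := Encodable.ofCountable 𝓕
  -- The Rasiowa–Sikorski lemma: this is where countability is used.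
  let J : Order.Ideal P := Order.idealOfCofinals ⟨H, hH, hd⟩ fun F : 𝓕 => ⟨_, hcof F.1⟩
  -- By directedness, finitely many formulas of the unions already lie in one member of `J`.
  have hpart : ∀ T : Sequent L, T.Within {φ | ∃ p ∈ J, φ ∈ p.1.ant} {φ | ∃ p ∈ J, φ ∈ p.1.suc} →
      ∃ p ∈ J, T ≤ p.1 := by
    have hl : ∀ Θ : Multiset (Formula L), (∀ φ ∈ Θ, ∃ p ∈ J, φ ∈ p.1.ant) →
        ∃ p ∈ J, Θ ⊆ p.1.ant := by
      intro Θ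
      induction Θ using Multiset.induction_on with
      | empty =>
          obtain ⟨p, hp⟩ := J.nonempty
          exact fun _ => ⟨p, hp, by simp⟩
      | cons φ Θ ih =>
          intro h
          obtain ⟨p, hp, hφ⟩ := h φ (by simp)
          obtain ⟨q, hq, hΘ⟩ := ih fun χ hχ => h χ (by simp [hχ])
          obtain ⟨r, hr, hpr, hqr⟩ := J.directed p hp q hq
          exact ⟨r, hr, Multiset.cons_subset.2
            ⟨(Sequent.le_def.1 hpr).1 hφ, Multiset.Subset.trans hΘ (Sequent.le_def.1 hqr).1⟩⟩
    have hr : ∀ Θ : Multiset (Formula L), (∀ φ ∈ Θ, ∃ p ∈ J, φ ∈ p.1.suc) →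
        ∃ p ∈ J, Θ ⊆ p.1.suc := by
      intro Θ
      induction Θ using Multiset.induction_on with
      | empty =>
          obtain ⟨p, hp⟩ := J.nonempty
          exact fun _ => ⟨p, hp, by simp⟩
      | cons φ Θ ih =>
          intro h
          obtain ⟨p, hp, hφ⟩ := h φ (by simp)
          obtain ⟨q, hq, hΘ⟩ := ih fun χ hχ => h χ (by simp [hχ])
          obtain ⟨r, hr, hpr, hqr⟩ := J.directed p hp q hq
          exact ⟨r, hr, Multiset.cons_subset.2
            ⟨(Sequent.le_def.1 hpr).2 hφ, Multiset.Subset.trans hΘ (Sequent.le_def.1 hqr).2⟩⟩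
    intro T hT
    obtain ⟨p, hp, hp'⟩ := hl T.ant hT.1
    obtain ⟨q, hq, hq'⟩ := hr T.suc hT.2
    obtain ⟨r, hr, hpr, hqr⟩ := J.directed p hp q hq
    exact ⟨r, hr, Multiset.Subset.trans hp' (Sequent.le_def.1 hpr).1,
      Multiset.Subset.trans hq' (Sequent.le_def.1 hqr).2⟩
  have hmem : ∀ p ∈ J, p.1.Within {φ | ∃ p ∈ J, φ ∈ p.1.ant} {φ | ∃ p ∈ J, φ ∈ p.1.suc} :=
    fun p hp => ⟨fun φ hφ => ⟨p, hp, hφ⟩, fun φ hφ => ⟨p, hp, hφ⟩⟩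
  refine ⟨{φ | ∃ p ∈ J, φ ∈ p.1.ant}, {φ | ∃ p ∈ J, φ ∈ p.1.suc},
    hmem _ (Order.mem_idealOfCofinals _ _), ?_, ?_, ?_, ?_⟩
  · rintro φ ⟨p, -, hφ⟩
    exact p.2.1 φ (.inl hφ)
  · rintro φ ⟨p, -, hφ⟩
    exact p.2.1 φ (.inr hφ)
  · intro T hT
    obtain ⟨p, -, hp⟩ := hpart T.1 T.2
    exact p.2.2 (hT.mono hp p.2.1)
  · intro F hF
    obtain ⟨p, hp, hpJ⟩ := Order.cofinal_meets_idealOfCofinals (P := P) ⟨H, hH, hd⟩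
      (fun F : 𝓕 => ⟨_, hcof F.1⟩) ⟨F, hF⟩
    rcases hp with ⟨T, hT, hTp⟩ | hp
    · exact .inl ⟨T, hT, fun φ hφ => ⟨p, hpJ, hTp.1 hφ⟩, fun φ hφ => ⟨p, hpJ, hTp.2 hφ⟩⟩
    -- `p` is itself a finite part, and the derivations over it persist to every larger part by
    -- monotonicity.
    · refine .inr ((eventually_ge_atTop (⟨p.1, hmem p hpJ⟩ : Part _ _)).mono ?_)
      intro U hU T hT hTc
      have hUc : U.1.Closed := by
        obtain ⟨q, -, hq⟩ := hpart U.1 U.2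
        exact fun φ hφ => q.2.1 φ (hφ.imp (fun h => hq.1 h) fun h => hq.2 h)
      exact (hp T hT hTc).mono (T := T + p.1) (U := T + U.1)
        (Sequent.add_le (Sequent.le_add_right _ _)
          (le_trans (b := U.1) hU (Sequent.le_add_left _ _))) (hTc.add hUc)

/-- The instances, at all individual parameters, of a sequent template. -/
def instances (l r : Multiset (Formula L × ℕ)) : Set (Sequent L) :=
  Set.range fun a => ⟨l.map fun p => p.1.subst p.2 (.par a),
    r.map fun p => p.1.subst p.2 (.par a)⟩

/-- The instances, at all `n`-ary relational parameters, of a sequent template. -/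
def relInstances (n : ℕ+) (l r : Multiset (Formula L × ℕ)) : Set (Sequent L) :=
  Set.range fun A => ⟨l.map fun p => p.1.substRel n p.2 (.par A),
    r.map fun p => p.1.substRel n p.2 (.par A)⟩

/-- The sequents stating that a tuple of parameters belongs to `B` if it belongs to `A`. -/
def inclInstances {n : ℕ+} (A B : RelName L n) : Set (Sequent L) :=
  Set.range fun a : Fin n → ℕ => ⟨{.rel (.name A) fun i => .name (.par (a i))},
    {.rel (.name B) fun i => .name (.par (a i))}⟩

/-- A pair of sets of closed formulas no finite part of which is derivable, and which is maximal
and contains witnesses as far as this is consistent. -/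
structure Saturated (S : Set (Sequent L)) (C Γ Δ : Set (Formula L)) : Prop where
  closed_ant : ∀ φ ∈ Γ, φ.Closed
  closed_suc : ∀ φ ∈ Δ, φ.Closed
  consistent : ∀ T : Part Γ Δ, ¬ Deriv S C T.1.ant T.1.suc
  decides : ∀ T, Decides S C Γ Δ {T}
  decides_instances : ∀ l r, Decides S C Γ Δ (instances l r)
  decides_relInstances : ∀ n l r, Decides S C Γ Δ (relInstances n l r)
  decides_inclInstances : ∀ {n : ℕ+} (A B : RelName L n), Decides S C Γ Δ (inclInstances A B)

/-- Templates are finite multisets over a countable set, so there are only countably many families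
to decide. -/
theorem exists_saturated [Countable L.Con] [∀ n, Countable (L.Pred n)]
    [∀ n, Countable (L.RelCon n)] {S : Set (Sequent L)} {C : Set (Formula L)}
    {H : Sequent L} (hH : H.Closed) (hd : ¬ Deriv S C H.ant H.suc) :
    ∃ Γ Δ : Set (Formula L), H.Within Γ Δ ∧ Saturated S C Γ Δ := by
  obtain ⟨Γ, Δ, hHw, hΓ, hΔ, hc, hdec⟩ := exists_decides hH hd
    (𝓕 := (Set.range fun T : Sequent L => {T}) ∪
      (Set.range fun p : _ × _ => instances p.1 p.2) ∪
      (Set.range fun p : ℕ+ × _ × _ => relInstances p.1 p.2.1 p.2.2) ∪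
      (Set.range fun p : Σ n : ℕ+, RelName L n × RelName L n => inclInstances p.2.1 p.2.2))
    ((((Set.countable_range _).union (Set.countable_range _)).union
      (Set.countable_range _)).union (Set.countable_range _))
  exact ⟨Γ, Δ, hHw, hΓ, hΔ, hc, fun T => hdec _ (.inl (.inl (.inl ⟨T, rfl⟩))),
    fun l r => hdec _ (.inl (.inl (.inr ⟨(l, r), rfl⟩))),
    fun n l r => hdec _ (.inl (.inr ⟨(n, l, r), rfl⟩)),
    fun {n} A B => hdec _ (.inr ⟨⟨n, A, B⟩, rfl⟩)⟩

open Formula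

theorem fresh_add {a : ℕ} {Γ Δ : Multiset (Formula L)} :
    Fresh a (Γ + Δ) ↔ Fresh a Γ ∧ Fresh a Δ := by
  simp only [Fresh, Multiset.mem_add]; grind

theorem fresh_cons {a : ℕ} {φ : Formula L} {Γ : Multiset (Formula L)} :
    Fresh a (φ ::ₘ Γ) ↔ ¬ φ.HasPar a ∧ Fresh a Γ := by
  simp [Fresh]

theorem freshRel_add {n : ℕ+} {A : ℕ} {Γ Δ : Multiset (Formula L)} :
    FreshRel n A (Γ + Δ) ↔ FreshRel n A Γ ∧ FreshRel n A Δ := by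
  simp only [FreshRel, Multiset.mem_add]; grind

theorem freshRel_cons {n : ℕ+} {A : ℕ} {φ : Formula L} {Γ : Multiset (Formula L)} :
    FreshRel n A (φ ::ₘ Γ) ↔ ¬ φ.HasRelPar n A ∧ FreshRel n A Γ := by
  simp [FreshRel]

/-! ### Consistency and maximality as eventual derivability -/

namespace Saturated

variable {S : Set (Sequent L)} {C Γ Δ : Set (Formula L)}

/-- Finite parts form a nonempty directed order, so what holds eventually holds somewhere. The
filter also lets several premises be derived over the same part. -/
theorem not_eventually (h : Saturated S C Γ Δ) :
    ¬ ∀ᶠ T : Part Γ Δ in atTop, Deriv S C T.1.ant T.1.suc := fun hT => by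
  obtain ⟨T, hT⟩ := hT.exists
  exact h.consistent T hT

theorem not_eventually_ant (h : Saturated S C Γ Δ) {φ : Formula L} (hφ : φ ∈ Γ) :
    ¬ ∀ᶠ T : Part Γ Δ in atTop, Deriv S C (φ ::ₘ T.1.ant) T.1.suc := fun hT => by
  obtain ⟨T, hT⟩ := hT.exists
  exact h.consistent ⟨⟨φ ::ₘ T.1.ant, T.1.suc⟩,
    fun χ hχ => (Multiset.mem_cons.1 hχ).elim (fun e => e ▸ hφ) (T.2.1 χ), T.2.2⟩ hT

theorem not_eventually_suc (h : Saturated S C Γ Δ) {φ : Formula L} (hφ : φ ∈ Δ) :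
    ¬ ∀ᶠ T : Part Γ Δ in atTop, Deriv S C T.1.ant (φ ::ₘ T.1.suc) := fun hT => by
  obtain ⟨T, hT⟩ := hT.exists
  exact h.consistent ⟨⟨T.1.ant, φ ::ₘ T.1.suc⟩, T.2.1,
    fun χ hχ => (Multiset.mem_cons.1 hχ).elim (fun e => e ▸ hφ) (T.2.2 χ)⟩ hT

theorem closed_part (h : Saturated S C Γ Δ) (T : Part Γ Δ) : T.1.Closed :=
  fun φ hφ => hφ.elim (fun hφ => h.closed_ant φ (T.2.1 φ hφ))
    fun hφ => h.closed_suc φ (T.2.2 φ hφ)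

/-- This replaces the usual dichotomy `φ ∈ Γ` or `φ ∈ Δ`, whose proof would cut on arbitrary
formulas. Absence from one side is all that is turned into derivability. -/
theorem eventually_of_not_within (h : Saturated S C Γ Δ) {U : Sequent L} (hU : U.Closed)
    (hw : ¬ U.Within Γ Δ) :
    ∀ᶠ T : Part Γ Δ in atTop, Deriv S C (U.ant + T.1.ant) (U.suc + T.1.suc) := by
  rcases h.decides U with ⟨T, rfl, hT⟩ | hd
  · exact (hw hT).elim
  · exact hd.mono fun T hT => hT U rfl hU

theorem eventually_ant (h : Saturated S C Γ Δ) {φ : Formula L} (hφ : φ.Closed) (hn : φ ∉ Γ) :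
    ∀ᶠ T : Part Γ Δ in atTop, Deriv S C (φ ::ₘ T.1.ant) T.1.suc := by
  simpa using h.eventually_of_not_within (U := ⟨{φ}, 0⟩) (by simpa [Sequent.Closed, Sequent.Has])
    (by simpa [Sequent.Within])

theorem eventually_suc (h : Saturated S C Γ Δ) {φ : Formula L} (hφ : φ.Closed) (hn : φ ∉ Δ) :
    ∀ᶠ T : Part Γ Δ in atTop, Deriv S C T.1.ant (φ ::ₘ T.1.suc) := by
  simpa using h.eventually_of_not_within (U := ⟨0, {φ}⟩) (by simpa [Sequent.Closed, Sequent.Has])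
    (by simpa [Sequent.Within])

theorem eventually_ant_ant (h : Saturated S C Γ Δ) {φ ψ : Formula L} (hφ : φ.Closed)
    (hψ : ψ.Closed) (hn : ¬ (φ ∈ Γ ∧ ψ ∈ Γ)) :
    ∀ᶠ T : Part Γ Δ in atTop, Deriv S C (φ ::ₘ ψ ::ₘ T.1.ant) T.1.suc := by
  simpa using h.eventually_of_not_within (U := ⟨{φ, ψ}, 0⟩)
    (by simp [Sequent.Closed, Sequent.Has, hφ, hψ]) (by simpa [Sequent.Within] using hn)

theorem eventually_suc_suc (h : Saturated S C Γ Δ) {φ ψ : Formula L} (hφ : φ.Closed)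
    (hψ : ψ.Closed) (hn : ¬ (φ ∈ Δ ∧ ψ ∈ Δ)) :
    ∀ᶠ T : Part Γ Δ in atTop, Deriv S C T.1.ant (φ ::ₘ ψ ::ₘ T.1.suc) := by
  simpa using h.eventually_of_not_within (U := ⟨0, {φ, ψ}⟩)
    (by simp [Sequent.Closed, Sequent.Has, hφ, hψ]) (by simpa [Sequent.Within] using hn)

theorem eventually_ant_suc (h : Saturated S C Γ Δ) {φ ψ : Formula L} (hφ : φ.Closed)
    (hψ : ψ.Closed) (hn : ¬ (φ ∈ Γ ∧ ψ ∈ Δ)) :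
    ∀ᶠ T : Part Γ Δ in atTop, Deriv S C (φ ::ₘ T.1.ant) (ψ ::ₘ T.1.suc) := by
  simpa using h.eventually_of_not_within (U := ⟨{φ}, {ψ}⟩)
    (by simp [Sequent.Closed, Sequent.Has, hφ, hψ]) (by simpa [Sequent.Within] using hn)

/-! #### Closure of saturated pairs under the rules -/

theorem not_mem_suc (h : Saturated S C Γ Δ) {φ : Formula L} (hφ : φ ∈ Γ) : φ ∉ Δ := fun hφ' =>
  h.consistent ⟨⟨{φ}, {φ}⟩, by simpa [Sequent.Within] using ⟨hφ, hφ'⟩⟩ (.ax (h.closed_ant φ hφ))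

/-- Otherwise every formula of `s` is absent from the side opposite to its own. Over one large part
each is then derivable there, and cuts with `s` derive that part. -/
theorem hyp (h : Saturated S C Γ Δ) {s : Sequent L} (hs : s ∈ S) (hsc : s.Closed)
    (hC : ∀ φ, s.Has φ → φ ∈ C) : (∃ φ ∈ s.ant, φ ∈ Δ) ∨ ∃ φ ∈ s.suc, φ ∈ Γ := by
  by_contra! hn
  refine h.not_eventually ?_
  have h₁ := (eventually_all_finite (l := (atTop : Filter (Part Γ Δ)))
    (Multiset.finite_toSet s.ant)).2 fun φ hφ => h.eventually_suc (hsc φ (.inl hφ)) (hn.1 φ hφ)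
  have h₂ := (eventually_all_finite (l := (atTop : Filter (Part Γ Δ)))
    (Multiset.finite_toSet s.suc)).2 fun φ hφ => h.eventually_ant (hsc φ (.inr hφ)) (hn.2 φ hφ)
  filter_upwards [h₁, h₂] with T h₁ h₂
  exact .of_hyp hs hC (h.closed_part T) h₁ h₂

/-- The pattern for all rules without eigenvariables: if the active formulas of every premise are
missing, the premises are derivable over a common part, and the rule contradicts consistency. -/
theorem neg_ant (h : Saturated S C Γ Δ) {φ : Formula L} (hm : neg φ ∈ Γ) : φ ∈ Δ := by
  by_contra hn
  refine h.not_eventually_ant hm ?_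
  filter_upwards [h.eventually_suc (closed_neg.1 (h.closed_ant _ hm)) hn] with T hT using .negL hT

theorem neg_suc (h : Saturated S C Γ Δ) {φ : Formula L} (hm : neg φ ∈ Δ) : φ ∈ Γ := by
  by_contra hn
  refine h.not_eventually_suc hm ?_
  filter_upwards [h.eventually_ant (closed_neg.1 (h.closed_suc _ hm)) hn] with T hT using .negR hT

theorem and_ant (h : Saturated S C Γ Δ) {φ ψ : Formula L} (hm : and φ ψ ∈ Γ) :
    φ ∈ Γ ∧ ψ ∈ Γ := by
  by_contra hn
  have hc := closed_and.1 (h.closed_ant _ hm)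
  refine h.not_eventually_ant hm ?_
  filter_upwards [h.eventually_ant_ant hc.1 hc.2 hn] with T hT using .andL hT

theorem and_suc (h : Saturated S C Γ Δ) {φ ψ : Formula L} (hm : and φ ψ ∈ Δ) :
    φ ∈ Δ ∨ ψ ∈ Δ := by
  by_contra! hn
  have hc := closed_and.1 (h.closed_suc _ hm)
  refine h.not_eventually_suc hm ?_
  filter_upwards [h.eventually_suc hc.1 hn.1, h.eventually_suc hc.2 hn.2] with T h₁ h₂
    using .andR h₁ h₂

theorem or_ant (h : Saturated S C Γ Δ) {φ ψ : Formula L} (hm : or φ ψ ∈ Γ) :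
    φ ∈ Γ ∨ ψ ∈ Γ := by
  by_contra! hn
  have hc := closed_or.1 (h.closed_ant _ hm)
  refine h.not_eventually_ant hm ?_
  filter_upwards [h.eventually_ant hc.1 hn.1, h.eventually_ant hc.2 hn.2] with T h₁ h₂
    using .orL h₁ h₂

theorem or_suc (h : Saturated S C Γ Δ) {φ ψ : Formula L} (hm : or φ ψ ∈ Δ) :
    φ ∈ Δ ∧ ψ ∈ Δ := by
  by_contra hn
  have hc := closed_or.1 (h.closed_suc _ hm)
  refine h.not_eventually_suc hm ?_
  filter_upwards [h.eventually_suc_suc hc.1 hc.2 hn] with T hT using .orR hT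

theorem imp_ant (h : Saturated S C Γ Δ) {φ ψ : Formula L} (hm : imp φ ψ ∈ Γ) :
    φ ∈ Δ ∨ ψ ∈ Γ := by
  by_contra! hn
  have hc := closed_imp.1 (h.closed_ant _ hm)
  refine h.not_eventually_ant hm ?_
  filter_upwards [h.eventually_suc hc.1 hn.1, h.eventually_ant hc.2 hn.2] with T h₁ h₂
    using .impL h₁ h₂

theorem imp_suc (h : Saturated S C Γ Δ) {φ ψ : Formula L} (hm : imp φ ψ ∈ Δ) :
    φ ∈ Γ ∧ ψ ∈ Δ := by
  by_contra hn
  have hc := closed_imp.1 (h.closed_suc _ hm)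
  refine h.not_eventually_suc hm ?_
  filter_upwards [h.eventually_ant_suc hc.1 hc.2 hn] with T hT using .impR hT

theorem iff_ant (h : Saturated S C Γ Δ) {φ ψ : Formula L} (hm : Formula.iff φ ψ ∈ Γ) :
    (φ ∈ Δ ∧ ψ ∈ Δ) ∨ (φ ∈ Γ ∧ ψ ∈ Γ) := by
  by_contra hn
  obtain ⟨hn₁, hn₂⟩ := not_or.1 hn
  have hc := closed_iff.1 (h.closed_ant _ hm)
  refine h.not_eventually_ant hm ?_
  filter_upwards [h.eventually_suc_suc hc.1 hc.2 hn₁, h.eventually_ant_ant hc.1 hc.2 hn₂]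
    with T h₁ h₂ using .iffL h₁ h₂

theorem iff_suc (h : Saturated S C Γ Δ) {φ ψ : Formula L} (hm : Formula.iff φ ψ ∈ Δ) :
    (φ ∈ Γ ∧ ψ ∈ Δ) ∨ (ψ ∈ Γ ∧ φ ∈ Δ) := by
  by_contra hn
  obtain ⟨hn₁, hn₂⟩ := not_or.1 hn
  have hc := closed_iff.1 (h.closed_suc _ hm)
  refine h.not_eventually_suc hm ?_
  filter_upwards [h.eventually_ant_suc hc.1 hc.2 hn₁, h.eventually_ant_suc hc.2 hc.1 hn₂]
    with T h₁ h₂ using .iffR h₁ h₂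

theorem all_ant (h : Saturated S C Γ Δ) {x : ℕ} {φ : Formula L} (hm : all x φ ∈ Γ)
    (b : Name L) : φ.subst x b ∈ Γ := by
  by_contra hn
  refine h.not_eventually_ant hm ?_
  filter_upwards [h.eventually_ant ((h.closed_ant _ hm).of_all b) hn] with T hT using .allL b hT

/-- The pattern for eigenvariable rules. If no parameter is a witness, one finite part `T` makes all
instances of the premise derivable simultaneously, so the parameter may be chosen after `T` and
fresh for it. -/
theorem all_suc (h : Saturated S C Γ Δ) {x : ℕ} {φ : Formula L} (hm : all x φ ∈ Δ) :
    ∃ b, φ.subst x b ∈ Δ := by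
  rcases h.decides_instances 0 {(φ, x)} with ⟨_, ⟨a, rfl⟩, hw⟩ | hd
  · exact ⟨.par a, hw.2 _ (by simp)⟩
  · refine (h.not_eventually_suc hm ?_).elim
    filter_upwards [hd] with T hT
    obtain ⟨a, -, hf⟩ := exists_fresh (φ ::ₘ (T.1.ant + T.1.suc)) Set.finite_empty
    simp only [fresh_cons, fresh_add] at hf
    refine .allR a hf.2.1 hf.2.2 hf.1 ?_
    simpa using hT _ ⟨a, rfl⟩ (by
      simpa [Sequent.Closed, Sequent.Has] using (h.closed_suc _ hm).of_all _)

theorem ex_ant (h : Saturated S C Γ Δ) {x : ℕ} {φ : Formula L} (hm : ex x φ ∈ Γ) :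
    ∃ b, φ.subst x b ∈ Γ := by
  rcases h.decides_instances {(φ, x)} 0 with ⟨_, ⟨a, rfl⟩, hw⟩ | hd
  · exact ⟨.par a, hw.1 _ (by simp)⟩
  · refine (h.not_eventually_ant hm ?_).elim
    filter_upwards [hd] with T hT
    obtain ⟨a, -, hf⟩ := exists_fresh (φ ::ₘ (T.1.ant + T.1.suc)) Set.finite_empty
    simp only [fresh_cons, fresh_add] at hf
    refine .exL a hf.2.1 hf.2.2 hf.1 ?_
    simpa using hT _ ⟨a, rfl⟩ (by
      simpa [Sequent.Closed, Sequent.Has] using (h.closed_ant _ hm).of_ex _)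

theorem ex_suc (h : Saturated S C Γ Δ) {x : ℕ} {φ : Formula L} (hm : ex x φ ∈ Δ)
    (b : Name L) : φ.subst x b ∈ Δ := by
  by_contra hn
  refine h.not_eventually_suc hm ?_
  filter_upwards [h.eventually_suc ((h.closed_suc _ hm).of_ex b) hn] with T hT using .exR b hT

theorem eq_refl (h : Saturated S C Γ Δ) (b : Name L) : eq (.name b) (.name b) ∈ Γ := by
  by_contra hn
  refine h.not_eventually ?_
  filter_upwards [h.eventually_ant (closed_eq_name b b) hn] with T hT using .eqPlus b hT

theorem eq_subst (h : Saturated S C Γ Δ) {x : ℕ} {φ : Formula L} {b c : Name L}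
    (hφ : φ.IsAtomic) (hbc : eq (.name b) (.name c) ∈ Γ) (hb : φ.subst x b ∈ Γ) :
    φ.subst x c ∈ Γ := by
  by_contra hn
  -- Which variables are free in an instance does not depend on the name, so closedness passes from
  -- `b` to `c`.
  have hcl : (φ.subst x c).Closed := by
    have := h.closed_ant _ hb
    simpa only [Closed, hasFree_subst, hasFreeRel_subst] using this
  obtain ⟨T, hT⟩ := (h.eventually_ant hcl hn).exists
  refine h.consistent ⟨⟨eq (.name b) (.name c) ::ₘ φ.subst x b ::ₘ T.1.ant, T.1.suc⟩, ?_, T.2.2⟩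
    (.eqMinus b c hφ hT)
  intro χ hχ
  rcases Multiset.mem_cons.1 hχ with rfl | hχ
  · exact hbc
  · rcases Multiset.mem_cons.1 hχ with rfl | hχ
    · exact hb
    · exact T.2.1 χ hχ

theorem lam_ant (h : Saturated S C Γ Δ) {x : ℕ} {ψ : Formula L} {b : Name L}
    (hm : lam x ψ (.name b) ∈ Γ) : ψ.subst x b ∈ Γ := by
  by_contra hn
  refine h.not_eventually_ant hm ?_
  filter_upwards [h.eventually_ant ((h.closed_ant _ hm).of_lam b) hn] with T hT using .lamL b hT

theorem lam_suc (h : Saturated S C Γ Δ) {x : ℕ} {ψ : Formula L} {b : Name L}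
    (hm : lam x ψ (.name b) ∈ Δ) : ψ.subst x b ∈ Δ := by
  by_contra hn
  refine h.not_eventually_suc hm ?_
  filter_upwards [h.eventually_suc ((h.closed_suc _ hm).of_lam b) hn] with T hT using .lamR b hT

theorem lamIota_ant (h : Saturated S C Γ Δ) {x y : ℕ} {ψ φ : Formula L}
    (hm : lamIota x ψ y φ ∈ Γ) : ∃ b, φ.subst y b ∈ Γ ∧ ψ.subst x b ∈ Γ := by
  rcases h.decides_instances {(φ, y), (ψ, x)} 0 with ⟨_, ⟨a, rfl⟩, hw⟩ | hd
  · exact ⟨.par a, hw.1 _ (by simp), hw.1 _ (by simp)⟩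
  · refine (h.not_eventually_ant hm ?_).elim
    have hc := h.closed_ant _ hm
    filter_upwards [hd] with T hT
    obtain ⟨a, -, hf⟩ := exists_fresh (φ ::ₘ ψ ::ₘ (T.1.ant + T.1.suc)) Set.finite_empty
    simp only [fresh_cons, fresh_add] at hf
    refine .iotaL₁ a hf.2.2.1 hf.2.2.2 hf.1 hf.2.1 ?_
    simpa using hT _ ⟨a, rfl⟩ (by
      simpa [Sequent.Closed, Sequent.Has] using ⟨hc.of_lamIota_right _, hc.of_lamIota_left _⟩)

theorem lamIota_ant_unique (h : Saturated S C Γ Δ) {x y : ℕ} {ψ φ : Formula L}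
    (hm : lamIota x ψ y φ ∈ Γ) (b c : Name L) :
    φ.subst y b ∈ Δ ∨ φ.subst y c ∈ Δ ∨ eq (.name b) (.name c) ∈ Γ := by
  by_contra! hn
  have hc := h.closed_ant _ hm
  refine h.not_eventually_ant hm ?_
  filter_upwards [h.eventually_suc (hc.of_lamIota_right b) hn.1,
    h.eventually_suc (hc.of_lamIota_right c) hn.2.1,
    h.eventually_ant (closed_eq_name b c) hn.2.2] with T h₁ h₂ h₃ using .iotaL₂ b c hc h₁ h₂ h₃

theorem lamIota_suc (h : Saturated S C Γ Δ) {x y : ℕ} {ψ φ : Formula L}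
    (hm : lamIota x ψ y φ ∈ Δ) (b : Name L) :
    φ.subst y b ∈ Δ ∨ ψ.subst x b ∈ Δ ∨
      ∃ c, φ.subst y c ∈ Γ ∧ eq (.name c) (.name b) ∈ Δ := by
  -- The template of the third premise of `iotaR`: its instance at `a` is `φ` at `a` on the left and
  -- `a = b` on the right.
  rcases h.decides_instances {(φ, y)} {(eq (.var 0) (.name b), 0)} with ⟨_, ⟨a, rfl⟩, hw⟩ | hd
  · exact .inr (.inr ⟨.par a, hw.1 _ (by simp), hw.2 _ (by simp [Formula.subst, Term.subst])⟩)
  · by_contra! hn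
    refine h.not_eventually_suc hm ?_
    have hc := h.closed_suc _ hm
    filter_upwards [hd, h.eventually_suc (hc.of_lamIota_right b) hn.1,
      h.eventually_suc (hc.of_lamIota_left b) hn.2.1] with T hT h₁ h₂
    obtain ⟨a, hab, hf⟩ := exists_fresh (φ ::ₘ ψ ::ₘ (T.1.ant + T.1.suc))
      (Term.finite_hasPar (.name b))
    simp only [fresh_cons, fresh_add] at hf
    refine .iotaR b a hf.2.2.1 hf.2.2.2 hf.1 hf.2.1 (fun e => hab (by subst e; rfl)) h₁ h₂ ?_
    simpa [Formula.subst, Term.subst] using hT _ ⟨a, rfl⟩ (by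
      simpa [Sequent.Closed, Sequent.Has, Formula.subst, Term.subst] using
        ⟨hc.of_lamIota_right _, closed_eq_name _ _⟩)

theorem relEq_ant (h : Saturated S C Γ Δ) {n : ℕ+} {A B : RelName L n}
    (hm : relEq (.name A) (.name B) ∈ Γ) (b : Fin n → Name L) :
    ((rel (.name A) fun i => .name (b i)) ∈ Δ ∧ (rel (.name B) fun i => .name (b i)) ∈ Δ) ∨
      ((rel (.name A) fun i => .name (b i)) ∈ Γ ∧ (rel (.name B) fun i => .name (b i)) ∈ Γ) := by
  by_contra hn
  obtain ⟨hn₁, hn₂⟩ := not_or.1 hn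
  refine h.not_eventually_ant hm ?_
  filter_upwards [h.eventually_suc_suc (closed_rel_name A b) (closed_rel_name B b) hn₁,
    h.eventually_ant_ant (closed_rel_name A b) (closed_rel_name B b) hn₂] with T h₁ h₂
    using .relEqL b h₁ h₂

/-- The two inclusions are separate families. If neither has a member within the pair, both are
refuted at every tuple over one part, hence at the same tuple of distinct fresh parameters, as
`relEqR` demands. -/
theorem relEq_suc (h : Saturated S C Γ Δ) {n : ℕ+} {A B : RelName L n}
    (hm : relEq (.name A) (.name B) ∈ Δ) : ∃ b : Fin n → Name L,
    ((rel (.name A) fun i => .name (b i)) ∈ Γ ∧ (rel (.name B) fun i => .name (b i)) ∈ Δ) ∨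
      ((rel (.name B) fun i => .name (b i)) ∈ Γ ∧ (rel (.name A) fun i => .name (b i)) ∈ Δ) := by
  rcases h.decides_inclInstances A B with ⟨_, ⟨a, rfl⟩, hw⟩ | hd₁
  · exact ⟨fun i => .par (a i), .inl ⟨hw.1 _ (by simp), hw.2 _ (by simp)⟩⟩
  rcases h.decides_inclInstances B A with ⟨_, ⟨a, rfl⟩, hw⟩ | hd₂
  · exact ⟨fun i => .par (a i), .inr ⟨hw.1 _ (by simp), hw.2 _ (by simp)⟩⟩
  refine (h.not_eventually_suc hm ?_).elim
  filter_upwards [hd₁, hd₂] with T h₁ h₂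
  obtain ⟨a, ha, hf⟩ := exists_injective_fresh n (T.1.ant + T.1.suc)
  simp only [fresh_add] at hf
  refine .relEqR a ha (fun i => (hf i).1) (fun i => (hf i).2) ?_ ?_
  · simpa using h₁ _ ⟨a, rfl⟩ (by
      simpa [Sequent.Closed, Sequent.Has] using ⟨closed_rel_name A _, closed_rel_name B _⟩)
  · simpa using h₂ _ ⟨a, rfl⟩ (by
      simpa [Sequent.Closed, Sequent.Has] using ⟨closed_rel_name B _, closed_rel_name A _⟩)

theorem all2_ant (h : Saturated S C Γ Δ) {n : ℕ+} {X : ℕ} {φ : Formula L}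
    (hm : all2 n X φ ∈ Γ) (B : RelName L n) : φ.substRel n X B ∈ Γ := by
  by_contra hn
  refine h.not_eventually_ant hm ?_
  filter_upwards [h.eventually_ant ((h.closed_ant _ hm).of_all2 B) hn] with T hT using .all2L B hT

theorem all2_suc (h : Saturated S C Γ Δ) {n : ℕ+} {X : ℕ} {φ : Formula L}
    (hm : all2 n X φ ∈ Δ) : ∃ B, φ.substRel n X B ∈ Δ := by
  rcases h.decides_relInstances n 0 {(φ, X)} with ⟨_, ⟨A, rfl⟩, hw⟩ | hd
  · exact ⟨.par A, hw.2 _ (by simp)⟩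
  · refine (h.not_eventually_suc hm ?_).elim
    filter_upwards [hd] with T hT
    obtain ⟨A, -, hf⟩ := exists_freshRel n (φ ::ₘ (T.1.ant + T.1.suc)) Set.finite_empty
    simp only [freshRel_cons, freshRel_add] at hf
    refine .all2R A hf.2.1 hf.2.2 hf.1 ?_
    simpa using hT _ ⟨A, rfl⟩ (by
      simpa [Sequent.Closed, Sequent.Has] using (h.closed_suc _ hm).of_all2 _)

theorem ex2_ant (h : Saturated S C Γ Δ) {n : ℕ+} {X : ℕ} {φ : Formula L}
    (hm : ex2 n X φ ∈ Γ) : ∃ B, φ.substRel n X B ∈ Γ := by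
  rcases h.decides_relInstances n {(φ, X)} 0 with ⟨_, ⟨A, rfl⟩, hw⟩ | hd
  · exact ⟨.par A, hw.1 _ (by simp)⟩
  · refine (h.not_eventually_ant hm ?_).elim
    filter_upwards [hd] with T hT
    obtain ⟨A, -, hf⟩ := exists_freshRel n (φ ::ₘ (T.1.ant + T.1.suc)) Set.finite_empty
    simp only [freshRel_cons, freshRel_add] at hf
    refine .ex2L A hf.2.1 hf.2.2 hf.1 ?_
    simpa using hT _ ⟨A, rfl⟩ (by
      simpa [Sequent.Closed, Sequent.Has] using (h.closed_ant _ hm).of_ex2 _)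

theorem ex2_suc (h : Saturated S C Γ Δ) {n : ℕ+} {X : ℕ} {φ : Formula L}
    (hm : ex2 n X φ ∈ Δ) (B : RelName L n) : φ.substRel n X B ∈ Δ := by
  by_contra hn
  refine h.not_eventually_suc hm ?_
  filter_upwards [h.eventually_suc ((h.closed_suc _ hm).of_ex2 B) hn] with T hT using .ex2R B hT

theorem lamIota2_ant (h : Saturated S C Γ Δ) {n : ℕ+} {X Y : ℕ} {ψ φ : Formula L}
    (hm : lamIota2 n X ψ Y φ ∈ Γ) : ∃ B, φ.substRel n Y B ∈ Γ ∧ ψ.substRel n X B ∈ Γ := by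
  rcases h.decides_relInstances n {(φ, Y), (ψ, X)} 0 with ⟨_, ⟨A, rfl⟩, hw⟩ | hd
  · exact ⟨.par A, hw.1 _ (by simp), hw.1 _ (by simp)⟩
  · refine (h.not_eventually_ant hm ?_).elim
    have hc := h.closed_ant _ hm
    filter_upwards [hd] with T hT
    obtain ⟨A, -, hf⟩ := exists_freshRel n (φ ::ₘ ψ ::ₘ (T.1.ant + T.1.suc)) Set.finite_empty
    simp only [freshRel_cons, freshRel_add] at hf
    refine .iota2L₁ A hf.2.2.1 hf.2.2.2 hf.1 hf.2.1 ?_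
    simpa using hT _ ⟨A, rfl⟩ (by
      simpa [Sequent.Closed, Sequent.Has] using ⟨hc.of_lamIota2_right _, hc.of_lamIota2_left _⟩)

theorem lamIota2_ant_unique (h : Saturated S C Γ Δ) {n : ℕ+} {X Y : ℕ} {ψ φ : Formula L}
    (hm : lamIota2 n X ψ Y φ ∈ Γ) (B B' : RelName L n) :
    φ.substRel n Y B ∈ Δ ∨ φ.substRel n Y B' ∈ Δ ∨ relEq (.name B) (.name B') ∈ Γ := by
  by_contra! hn
  have hc := h.closed_ant _ hm
  refine h.not_eventually_ant hm ?_
  filter_upwards [h.eventually_suc (hc.of_lamIota2_right B) hn.1,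
    h.eventually_suc (hc.of_lamIota2_right B') hn.2.1,
    h.eventually_ant (closed_relEq_name B B') hn.2.2] with T h₁ h₂ h₃
    using .iota2L₂ B B' hc h₁ h₂ h₃

theorem lamIota2_suc (h : Saturated S C Γ Δ) {n : ℕ+} {X Y : ℕ} {ψ φ : Formula L}
    (hm : lamIota2 n X ψ Y φ ∈ Δ) (B : RelName L n) :
    φ.substRel n Y B ∈ Δ ∨ ψ.substRel n X B ∈ Δ ∨
      ∃ B', φ.substRel n Y B' ∈ Γ ∧ relEq (.name B') (.name B) ∈ Δ := by
  rcases h.decides_relInstances n {(φ, Y)} {(relEq (.var 0) (.name B), 0)} with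
    ⟨_, ⟨A, rfl⟩, hw⟩ | hd
  · exact .inr (.inr ⟨.par A, hw.1 _ (by simp),
      hw.2 _ (by simp [Formula.substRel, RelTerm.subst])⟩)
  · by_contra! hn
    refine h.not_eventually_suc hm ?_
    have hc := h.closed_suc _ hm
    filter_upwards [hd, h.eventually_suc (hc.of_lamIota2_right B) hn.1,
      h.eventually_suc (hc.of_lamIota2_left B) hn.2.1] with T hT h₁ h₂
    obtain ⟨A, hAB, hf⟩ := exists_freshRel n (φ ::ₘ ψ ::ₘ (T.1.ant + T.1.suc))
      (RelTerm.finite_hasPar n (.name B))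
    simp only [freshRel_cons, freshRel_add] at hf
    refine .iota2R B A hf.2.2.1 hf.2.2.2 hf.1 hf.2.1
      (fun e => hAB (by subst e; exact ⟨rfl, rfl⟩)) h₁ h₂ ?_
    simpa [Formula.substRel, RelTerm.subst] using hT _ ⟨A, rfl⟩ (by
      simpa [Sequent.Closed, Sequent.Has, Formula.substRel, RelTerm.subst] using
        ⟨hc.of_lamIota2_right _, closed_relEq_name _ _⟩)

end Saturated

/-! ### The term model of a saturated pair -/

namespace Saturated

variable {S : Set (Sequent L)} {C Γ Δ : Set (Formula L)}

/-- Leibniz's law applied to the left-hand place of `b = b`. -/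
theorem eq_symm (h : Saturated S C Γ Δ) {b c : Name L} (hbc : eq (.name b) (.name c) ∈ Γ) :
    eq (.name c) (.name b) ∈ Γ := by
  simpa [Formula.subst, Term.subst] using
    h.eq_subst (x := 0) (φ := eq (.var 0) (.name b)) trivial hbc
      (by simpa [Formula.subst, Term.subst] using h.eq_refl b)

theorem eq_trans (h : Saturated S C Γ Δ) {b c d : Name L} (hbc : eq (.name b) (.name c) ∈ Γ)
    (hcd : eq (.name c) (.name d) ∈ Γ) : eq (.name b) (.name d) ∈ Γ := by
  simpa [Formula.subst, Term.subst] using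
    h.eq_subst (x := 0) (φ := eq (.name b) (.var 0)) trivial hcd
      (by simpa [Formula.subst, Term.subst] using hbc)

/-- Names are identified if their equality is asserted. -/
def setoid (h : Saturated S C Γ Δ) : Setoid (Name L) where
  r b c := eq (.name b) (.name c) ∈ Γ
  iseqv := ⟨h.eq_refl, h.eq_symm, h.eq_trans⟩

/-- The domain of the term model. -/
abbrev Dom (h : Saturated S C Γ Δ) : Type := Quotient h.setoid

theorem mk_eq_mk (h : Saturated S C Γ Δ) {b c : Name L} :
    (Quotient.mk h.setoid b = Quotient.mk h.setoid c) ↔ eq (.name b) (.name c) ∈ Γ :=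
  Quotient.eq

/-- Equal names may be exchanged in all places of an atomic formula. -/
theorem congr_names (h : Saturated S C Γ Δ) {n : ℕ} {R : (Fin n → Term L) → Formula L}
    (hR : ∀ ts, (R ts).IsAtomic)
    (hsub : ∀ ts x b, (R ts).subst x b = R fun i => (ts i).subst x b) {b c : Fin n → Name L}
    (hbc : ∀ i, eq (.name (b i)) (.name (c i)) ∈ Γ) (hb : (R fun i => .name (b i)) ∈ Γ) :
    (R fun i => .name (c i)) ∈ Γ := by
  classical
  -- Names are exchanged one place at a time; variable `0` marks the place `j`, so other occurrences
  -- of the same name stay untouched.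
  have key : ∀ s : Finset (Fin n), (R fun i => .name (if i ∈ s then c i else b i)) ∈ Γ := by
    intro s
    induction s using Finset.induction_on with
    | empty => simpa using hb
    | insert j s hj ih =>
        have := h.eq_subst (x := 0) (hR fun i => if i = j then .var 0 else
          .name (if i ∈ s then c i else b i)) (hbc j) (by
            rw [hsub]
            convert ih using 3 with i
            by_cases hi : i = j
            · subst hi; simp [Term.subst, hj]
            · simp [Term.subst, hi])
        rw [hsub] at this
        convert this using 3 with i
        by_cases hi : i = j
        · subst hi; simp [Term.subst]
        · simp [Term.subst, hi]
  simpa using key Finset.univ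

/-- The relation on the term model of the tuples for which `R` is asserted. -/
def asserted (h : Saturated S C Γ Δ) {n : ℕ} (R : (Fin n → Term L) → Formula L) :
    Set (Fin n → h.Dom) :=
  {d | ∃ b : Fin n → Name L, (d = fun i => Quotient.mk h.setoid (b i)) ∧
    (R fun i => .name (b i)) ∈ Γ}

theorem mem_asserted (h : Saturated S C Γ Δ) {n : ℕ} {R : (Fin n → Term L) → Formula L}
    (hR : ∀ ts, (R ts).IsAtomic)
    (hsub : ∀ ts x b, (R ts).subst x b = R fun i => (ts i).subst x b) (b : Fin n → Name L) :
    (fun i => Quotient.mk h.setoid (b i)) ∈ h.asserted R ↔ (R fun i => .name (b i)) ∈ Γ := by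
  constructor
  · rintro ⟨c, hc, hm⟩
    exact h.congr_names hR hsub (fun i => h.mk_eq_mk.1 (congrFun hc i).symm) hm
  · exact fun hm => ⟨b, rfl, hm⟩

/-- The relation denoted by a relational name in the term model. -/
def relVal (h : Saturated S C Γ Δ) {n : ℕ+} (B : RelName L n) : Set (Fin n → h.Dom) :=
  h.asserted (Formula.rel (.name B))

theorem mem_relVal (h : Saturated S C Γ Δ) {n : ℕ+} {B : RelName L n} (b : Fin n → Name L) :
    (fun i => Quotient.mk h.setoid (b i)) ∈ h.relVal B ↔
      (rel (.name B) fun i => .name (b i)) ∈ Γ :=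
  h.mem_asserted (R := rel (.name B)) (fun _ => trivial) (fun _ _ _ => rfl) b

/-- The term model: its individuals are the classes of names, its relations those denoted by
relational names. -/
def model (h : Saturated S C Γ Δ) : GeneralModel L where
  D := h.Dom
  con k := Quotient.mk _ (.con k)
  pred P := h.asserted (Formula.pred P)
  G n := Set.range fun B : RelName L n => h.relVal B
  relCon K := ⟨h.relVal (.con K), .con K, rfl⟩

/-- The class of a name, as an individual of the term model. -/
def ind (h : Saturated S C Γ Δ) (b : Name L) : h.model.D := Quotient.mk h.setoid b

/-- The value of a relational name, as a relation of the term model. -/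
def relInd (h : Saturated S C Γ Δ) {n : ℕ+} (B : RelName L n) : h.model.G n :=
  ⟨h.relVal B, B, rfl⟩

theorem exists_ind (h : Saturated S C Γ Δ) (o : h.model.D) : ∃ b, h.ind b = o :=
  Quotient.exists_rep o

theorem exists_relInd (h : Saturated S C Γ Δ) {n : ℕ+} (O : h.model.G n) :
    ∃ B, h.relInd B = O := by
  obtain ⟨_, B, rfl⟩ := O
  exact ⟨B, rfl⟩

theorem ind_eq_ind (h : Saturated S C Γ Δ) {b c : Name L} :
    h.ind b = h.ind c ↔ eq (.name b) (.name c) ∈ Γ := h.mk_eq_mk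

theorem ind_ne_ind (h : Saturated S C Γ Δ) {b c : Name L}
    (hm : eq (.name b) (.name c) ∈ Δ) : h.ind b ≠ h.ind c :=
  fun e => h.not_mem_suc (h.ind_eq_ind.1 e) hm

/-- At each tuple the two atoms lie both in `Γ` or both in `Δ`, and in the latter case neither is in
`Γ`. Relational names need not be quotiented: their values are sets, and extensional equality does
the identification. -/
theorem relInd_eq_relInd (h : Saturated S C Γ Δ) {n : ℕ+} {A B : RelName L n}
    (hm : relEq (.name A) (.name B) ∈ Γ) : h.relInd A = h.relInd B := by
  refine Subtype.ext (Set.ext fun d => ?_)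
  obtain ⟨b, rfl⟩ : ∃ b : Fin n → Name L, (fun i => Quotient.mk h.setoid (b i)) = d :=
    ⟨fun i => (d i).out, funext fun i => (d i).out_eq⟩
  refine (h.mem_relVal b).trans (Iff.trans ?_ (h.mem_relVal b).symm)
  rcases h.relEq_ant hm b with hd | hg
  · exact iff_of_false (fun hA => h.not_mem_suc hA hd.1) fun hB => h.not_mem_suc hB hd.2
  · exact iff_of_true hg.1 hg.2

theorem relInd_ne_relInd (h : Saturated S C Γ Δ) {n : ℕ+} {A B : RelName L n}
    (hm : relEq (.name A) (.name B) ∈ Δ) : h.relInd A ≠ h.relInd B := by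
  intro e
  have e : h.relVal A = h.relVal B := congrArg Subtype.val e
  obtain ⟨b, hb⟩ := h.relEq_suc hm
  have hAB := h.mem_relVal (B := A) b
  rw [e, h.mem_relVal] at hAB
  rcases hb with hb | hb
  · exact h.not_mem_suc (hAB.2 hb.1) hb.2
  · exact h.not_mem_suc (hAB.1 hb.1) hb.2

/-- The assignment evaluates every parameter as itself. -/
structure IsCanonical (h : Saturated S C Γ Δ) (v : Assignment h.model) : Prop where
  par : ∀ a, v.par a = h.ind (.par a)
  relPar : ∀ (n : ℕ+) A, v.relPar n A = h.relInd (.par A)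

namespace IsCanonical

variable {h : Saturated S C Γ Δ} {v : Assignment h.model}

theorem term_name (hv : h.IsCanonical v) (b : Name L) : v.term (.name b) = h.ind b := by
  cases b with
  | par a => exact hv.par a
  | con k => rfl

theorem relTerm_name (hv : h.IsCanonical v) {n : ℕ+} (B : RelName L n) :
    v.relTerm (.name B) = h.relInd B := by
  cases B with
  | par A => exact hv.relPar n A
  | con K => rfl

/-- As every individual is some `h.ind b`, this reduces quantification in the model to instances by
names. -/
theorem sat_update (hv : h.IsCanonical v) (x : ℕ) (b : Name L) (φ : Formula L) :
    Sat h.model (v.update x (h.ind b)) φ ↔ Sat h.model v (φ.subst x b) := by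
  rw [sat_subst, hv.term_name]

theorem sat_updateRel (hv : h.IsCanonical v) {n : ℕ+} (X : ℕ) (B : RelName L n)
    (φ : Formula L) :
    Sat h.model (v.updateRel n X (h.relInd B)) φ ↔ Sat h.model v (φ.substRel n X B) := by
  rw [sat_substRel, hv.relTerm_name]

end IsCanonical

/-- The term model satisfies the formulas of `Γ` and falsifies those of `Δ`. -/
theorem truth (h : Saturated S C Γ Δ) {v : Assignment h.model} (hv : h.IsCanonical v)
    (φ : Formula L) :
    (φ ∈ Γ → Sat h.model v φ) ∧ (φ ∈ Δ → ¬ Sat h.model v φ) := by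
  -- The induction is on size, since the hypothesis is needed for instances by names, which are not
  -- subformulas but have the size of the formula substituted into.
  induction hN : φ.size using Nat.strong_induction_on generalizing φ with
  | _ N IH =>
  have ih : ∀ χ : Formula L, χ.size < φ.size →
      (χ ∈ Γ → Sat h.model v χ) ∧ (χ ∈ Δ → ¬ Sat h.model v χ) :=
    fun χ hχ => IH χ.size (hN ▸ hχ) χ rfl
  clear IH hN
  have hnames : ∀ {n : ℕ} {ts : Fin n → Term L}, (∀ i z, ¬ (ts i).HasVar z) →
      ∃ b : Fin n → Name L, ts = fun i => .name (b i) := by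
    intro n ts hts
    choose b hb using fun i => Term.exists_name_of_forall_not_hasVar (hts i)
    exact ⟨b, funext hb⟩
  -- A formula on neither side needs no argument. One on either side is closed, so the terms exposed
  -- at its top level are names.
  by_cases hm : φ ∈ Γ ∨ φ ∈ Δ
  swap
  · exact ⟨fun hφ => (hm (.inl hφ)).elim, fun hφ => (hm (.inr hφ)).elim⟩
  have hφc : φ.Closed := hm.elim (h.closed_ant φ) (h.closed_suc φ)
  clear hm
  cases φ with
  | eq t s =>
      obtain ⟨b, rfl⟩ := Term.exists_name_of_forall_not_hasVar fun z hz => hφc.1 z (.inl hz)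
      obtain ⟨c, rfl⟩ := Term.exists_name_of_forall_not_hasVar fun z hz => hφc.1 z (.inr hz)
      simp only [Sat, hv.term_name]
      exact ⟨h.ind_eq_ind.2, h.ind_ne_ind⟩
  | pred P ts =>
      obtain ⟨b, rfl⟩ := hnames fun i z hz => hφc.1 z ⟨i, hz⟩
      simp only [Sat, hv.term_name]
      have := h.mem_asserted (R := Formula.pred P) (fun _ => trivial) (fun _ _ _ => rfl) b
      exact ⟨this.2, fun hm hs => h.not_mem_suc (this.1 hs) hm⟩
  | relEq U V =>
      obtain ⟨A, rfl⟩ := RelTerm.exists_name_of_forall_not_hasVar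
        fun m Z hz => hφc.2 m Z (.inl hz)
      obtain ⟨B, rfl⟩ := RelTerm.exists_name_of_forall_not_hasVar
        fun m Z hz => hφc.2 m Z (.inr hz)
      simp only [Sat, hv.relTerm_name]
      exact ⟨h.relInd_eq_relInd, h.relInd_ne_relInd⟩
  | rel U ts =>
      obtain ⟨b, rfl⟩ := hnames fun i z hz => hφc.1 z ⟨i, hz⟩
      obtain ⟨B, rfl⟩ := RelTerm.exists_name_of_forall_not_hasVar fun m Z hz => hφc.2 m Z hz
      simp only [Sat, hv.term_name, hv.relTerm_name]
      exact ⟨(h.mem_relVal b).2, fun hm hs => h.not_mem_suc ((h.mem_relVal b).1 hs) hm⟩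
  | neg φ =>
      have h₁ := ih φ (by simp [size])
      exact ⟨fun hm => h₁.2 (h.neg_ant hm), fun hm hs => hs (h₁.1 (h.neg_suc hm))⟩
  | and φ ψ =>
      have h₁ := ih φ (by simp only [size]; lia)
      have h₂ := ih ψ (by simp only [size]; lia)
      exact ⟨fun hm => ⟨h₁.1 (h.and_ant hm).1, h₂.1 (h.and_ant hm).2⟩, fun hm hs =>
        (h.and_suc hm).elim (fun hm => h₁.2 hm hs.1) fun hm => h₂.2 hm hs.2⟩
  | or φ ψ =>
      have h₁ := ih φ (by simp only [size]; lia)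
      have h₂ := ih ψ (by simp only [size]; lia)
      exact ⟨fun hm => (h.or_ant hm).imp h₁.1 h₂.1, fun hm hs =>
        hs.elim (h₁.2 (h.or_suc hm).1) (h₂.2 (h.or_suc hm).2)⟩
  | imp φ ψ =>
      have h₁ := ih φ (by simp only [size]; lia)
      have h₂ := ih ψ (by simp only [size]; lia)
      exact ⟨fun hm hs => (h.imp_ant hm).elim (fun hm => (h₁.2 hm hs).elim) h₂.1, fun hm hs =>
        h₂.2 (h.imp_suc hm).2 (hs (h₁.1 (h.imp_suc hm).1))⟩
  | iff φ ψ =>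
      have h₁ := ih φ (by simp only [size]; lia)
      have h₂ := ih ψ (by simp only [size]; lia)
      refine ⟨fun hm => ?_, fun hm hs => ?_⟩
      · rcases h.iff_ant hm with hm | hm
        · exact iff_of_false (h₁.2 hm.1) (h₂.2 hm.2)
        · exact iff_of_true (h₁.1 hm.1) (h₂.1 hm.2)
      · rcases h.iff_suc hm with hm | hm
        · exact h₂.2 hm.2 (hs.1 (h₁.1 hm.1))
        · exact h₁.2 hm.2 (hs.2 (h₂.1 hm.1))
  | all x φ =>
      have ih' := fun b => ih (φ.subst x b) (by simp [size])
      refine ⟨fun hm o => ?_, fun hm hs => ?_⟩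
      · obtain ⟨b, rfl⟩ := h.exists_ind o
        exact (hv.sat_update x b φ).2 ((ih' b).1 (h.all_ant hm b))
      · obtain ⟨b, hb⟩ := h.all_suc hm
        exact (ih' b).2 hb ((hv.sat_update x b φ).1 (hs _))
  | ex x φ =>
      have ih' := fun b => ih (φ.subst x b) (by simp [size])
      refine ⟨fun hm => ?_, fun hm ⟨o, hs⟩ => ?_⟩
      · obtain ⟨b, hb⟩ := h.ex_ant hm
        exact ⟨_, (hv.sat_update x b φ).2 ((ih' b).1 hb)⟩
      · obtain ⟨b, rfl⟩ := h.exists_ind o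
        exact (ih' b).2 (h.ex_suc hm b) ((hv.sat_update x b φ).1 hs)
  | lam x ψ t =>
      obtain ⟨b, rfl⟩ := Term.exists_name_of_forall_not_hasVar fun z hz => hφc.1 z (.inr hz)
      have ih' := ih (ψ.subst x b) (by simp [size])
      simp only [Sat, hv.term_name, hv.sat_update]
      exact ⟨fun hm => ih'.1 (h.lam_ant hm), fun hm => ih'.2 (h.lam_suc hm)⟩
  | lamIota x ψ y φ =>
      have ih₁ := fun b => ih (ψ.subst x b) (by simp only [size, size_subst]; lia)
      have ih₂ := fun b => ih (φ.subst y b) (by simp only [size, size_subst]; lia)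
      refine ⟨fun hm => ?_, fun hm ⟨o, hs₁, hs₂, hu⟩ => ?_⟩
      · obtain ⟨b, hφ, hψ⟩ := h.lamIota_ant hm
        refine ⟨h.ind b, (hv.sat_update x b ψ).2 ((ih₁ b).1 hψ),
          (hv.sat_update y b φ).2 ((ih₂ b).1 hφ), fun o' ho' => ?_⟩
        obtain ⟨c, rfl⟩ := h.exists_ind o'
        rw [hv.sat_update] at ho'
        -- Of the three alternatives, the first contradicts that `c` satisfies `φ`, the second that
        -- the instance at `b` is in `Γ`; `c = b` remains.
        rcases h.lamIota_ant_unique hm c b with hc | hb | he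
        · exact ((ih₂ c).2 hc ho').elim
        · exact (h.not_mem_suc hφ hb).elim
        · exact h.ind_eq_ind.2 he
      · obtain ⟨b, rfl⟩ := h.exists_ind o
        rw [hv.sat_update] at hs₁ hs₂
        rcases h.lamIota_suc hm b with hφ | hψ | ⟨c, hc, he⟩
        · exact (ih₂ b).2 hφ hs₂
        · exact (ih₁ b).2 hψ hs₁
        -- The instance at `c` is true, so uniqueness would identify `c` with `b`, although `c = b`
        -- lies in `Δ`.
        · exact h.ind_ne_ind he (hu _ ((hv.sat_update y c φ).2 ((ih₂ c).1 hc)))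
  | all2 n X φ =>
      have ih' := fun B => ih (φ.substRel n X B) (by simp [size])
      refine ⟨fun hm O => ?_, fun hm hs => ?_⟩
      · obtain ⟨B, rfl⟩ := h.exists_relInd O
        exact (hv.sat_updateRel X B φ).2 ((ih' B).1 (h.all2_ant hm B))
      · obtain ⟨B, hB⟩ := h.all2_suc hm
        exact (ih' B).2 hB ((hv.sat_updateRel X B φ).1 (hs _))
  | ex2 n X φ =>
      have ih' := fun B => ih (φ.substRel n X B) (by simp [size])
      refine ⟨fun hm => ?_, fun hm ⟨O, hs⟩ => ?_⟩
      · obtain ⟨B, hB⟩ := h.ex2_ant hm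
        exact ⟨_, (hv.sat_updateRel X B φ).2 ((ih' B).1 hB)⟩
      · obtain ⟨B, rfl⟩ := h.exists_relInd O
        exact (ih' B).2 (h.ex2_suc hm B) ((hv.sat_updateRel X B φ).1 hs)
  | lamIota2 n X ψ Y φ =>
      have ih₁ := fun B => ih (ψ.substRel n X B) (by simp only [size, size_substRel]; lia)
      have ih₂ := fun B => ih (φ.substRel n Y B) (by simp only [size, size_substRel]; lia)
      refine ⟨fun hm => ?_, fun hm ⟨O, hs₁, hs₂, hu⟩ => ?_⟩
      · obtain ⟨B, hφ, hψ⟩ := h.lamIota2_ant hm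
        refine ⟨h.relInd B, (hv.sat_updateRel X B ψ).2 ((ih₁ B).1 hψ),
          (hv.sat_updateRel Y B φ).2 ((ih₂ B).1 hφ), fun O' hO' => ?_⟩
        obtain ⟨B', rfl⟩ := h.exists_relInd O'
        rw [hv.sat_updateRel] at hO'
        rcases h.lamIota2_ant_unique hm B' B with hB' | hB | he
        · exact ((ih₂ B').2 hB' hO').elim
        · exact (h.not_mem_suc hφ hB).elim
        · exact h.relInd_eq_relInd he
      · obtain ⟨B, rfl⟩ := h.exists_relInd O
        rw [hv.sat_updateRel] at hs₁ hs₂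
        rcases h.lamIota2_suc hm B with hφ | hψ | ⟨B', hB', he⟩
        · exact (ih₂ B).2 hφ hs₂
        · exact (ih₁ B).2 hψ hs₁
        · exact h.relInd_ne_relInd he (hu _ ((hv.sat_updateRel Y B' φ).2 ((ih₂ B').1 hB')))

/-- The sequents of `S` hold in the term model under the canonical assignments. -/
theorem holds_of_mem (h : Saturated S C Γ Δ) {v : Assignment h.model} (hv : h.IsCanonical v)
    {s : Sequent L} (hs : s ∈ S) (hsc : s.Closed) (hC : ∀ φ, s.Has φ → φ ∈ C) :
    s.Holds h.model v := by
  intro hant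
  rcases h.hyp hs hsc hC with ⟨φ, hφ, hφΔ⟩ | ⟨φ, hφ, hφΓ⟩
  · exact ((h.truth hv φ).2 hφΔ (hant φ hφ)).elim
  · exact ⟨φ, hφ, (h.truth hv φ).1 hφΓ⟩

theorem not_holds_of_within (h : Saturated S C Γ Δ) {v : Assignment h.model}
    (hv : h.IsCanonical v) {H : Sequent L} (hH : H.Within Γ Δ) : ¬ H.Holds h.model v := by
  intro hh
  obtain ⟨ψ, hψ, hs⟩ := hh fun φ hφ => (h.truth hv φ).1 (hH.1 φ hφ)
  exact (h.truth hv ψ).2 (hH.2 ψ hψ) hs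

/-- A canonical assignment with the given values of the variables. -/
def canonical (h : Saturated S C Γ Δ) (f : ℕ → h.model.D) (g : (n : ℕ+) → ℕ → h.model.G n) :
    Assignment h.model where
  var := f
  par a := h.ind (.par a)
  relVar := g
  relPar _ A := h.relInd (.par A)

theorem isCanonical_canonical (h : Saturated S C Γ Δ) (f : ℕ → h.model.D)
    (g : (n : ℕ+) → ℕ → h.model.G n) : h.IsCanonical (h.canonical f g) :=
  ⟨fun _ => rfl, fun _ _ => rfl⟩

/-- Every assignment into the term model arises from a canonical one by substituting names for
parameters. -/
theorem exists_canonical_comp (h : Saturated S C Γ Δ) (v : Assignment h.model) :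
    ∃ σ : ParSubst L, ∃ u, h.IsCanonical u ∧ u.comp σ = v := by
  choose σ hσ using fun a => h.exists_ind (v.par a)
  choose τ hτ using fun n A => h.exists_relInd (v.relPar n A)
  have hu := h.isCanonical_canonical v.var v.relVar
  refine ⟨⟨σ, τ⟩, _, hu, ?_⟩
  simp only [Assignment.comp, hu.term_name, hu.relTerm_name, hσ, hτ]
  rfl

end Saturated

end RLL

/-! ### Strong completeness, local and global -/

theorem mainTheorem1 (L : RLL.Signature) [Countable L.Con] [∀ n, Countable (L.Pred n)]
    [∀ n, Countable (L.RelCon n)] (S : Set (RLL.Sequent L)) (H : RLL.Sequent L)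
    (hS : ∀ s ∈ S, s.Closed) (hH : H.Closed) :
    (RLL.Entails S H → RLL.DerivableCF S H) ∧
    (RLL.SubstClosed S → RLL.EntailsGlobally S H → RLL.DerivableCF S H) := by
  refine ⟨fun hE => ?_, fun hsub hE => ?_⟩
  all_goals
    by_contra hd
    obtain ⟨Γ, Δ, hw, h⟩ := RLL.exists_saturated hH hd
    -- The values of the variables are arbitrary; parameter `0` only provides some value.
    have hv := h.isCanonical_canonical (fun _ => h.ind (.par 0)) fun _ _ => h.relInd (.par 0)
    refine h.not_holds_of_within hv hw ?_
  · exact hE h.model _ fun s hs => h.holds_of_mem hv hs (hS s hs) fun φ hφ => ⟨s, hs, hφ⟩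
  · refine hE h.model (fun s hs v => ?_) _
    obtain ⟨σ, u, hu, rfl⟩ := h.exists_canonical_comp v
    -- The instance of `s` under `σ` is again in `S`, so it holds under the canonical `u`; this says
    -- that `s` holds under `u.comp σ`, the given assignment.
    have hσ := hsub s hs σ
    exact (RLL.Sequent.holds_parSubst σ s u).1
      (h.holds_of_mem hu hσ (hS _ hσ) fun φ hφ => ⟨_, hσ, hφ⟩)
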